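/- A graph $T=(V,F)$ is a threshold graph if there are $s\in\mathbb R$ and $w:V\to\mathbb R$ such that for all distinct $u,v\in V$: $uv\in F \iff w(u)+w(v)\ge s$. The threshold dimension $t(G)$ of a finite graph $G$ is the minimum number of threshold subgraphs of $G$ that cover $E(G)$. A graph is co-bipartite if its complement is bipartite. There is a polynomial-time algorithm that, given a co-bipartite graph $G$ on $n\ge 3$ vertices (by its adjacency matrix), computes a natural number $a(G)$ with $$t(G)\;\le\; a(G)\;\le\; 2\left\lceil \frac{n\sqrt{\log\log n}}{\sqrt{\log n}}\right\rceil\, t(G).$$ Here $\log$ is the natural logarithm (the factor is at least as large, for every $n\ge 3$, when $\log$ is read to base $2$), and polynomial time means that some Turing machine computes $a$, with output in binary, in a number of steps bounded by a polynomial in the length of the input. -/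

import Mathlib

/-- `G` is a threshold graph: there are real vertex weights `w` and a real bound `s` such that two
distinct vertices are adjacent exactly when the sum of their weights is at least `s`. -/
def SimpleGraph.IsThreshold {V : Type*} (G : SimpleGraph V) : Prop :=
  ∃ (s : ℝ) (w : V → ℝ), ∀ u v : V, u ≠ v → (G.Adj u v ↔ s ≤ w u + w v)

/-- `E(G)` is covered by `k` threshold subgraphs of `G`, i.e. `E(G)` is the union of the edge sets
of `k` threshold graphs on the vertex set of `G`. -/
def SimpleGraph.HasThresholdCover {V : Type*} (G : SimpleGraph V) (k : ℕ) : Prop :=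
  ∃ T : Fin k → SimpleGraph V,
    (∀ i, (T i).IsThreshold) ∧ G.edgeSet = ⋃ i, (T i).edgeSet

/-- The threshold dimension `t(G)`: the least number of threshold subgraphs covering `E(G)`. -/
noncomputable def SimpleGraph.thresholdDim {V : Type*} (G : SimpleGraph V) : ℕ :=
  sInf {k : ℕ | G.HasThresholdCover k}

/-- A finite graph can be covered by threshold subgraphs (single edges), so that the minimum in
the definition of the threshold dimension is attained. -/
theorem SimpleGraph.hasThresholdCover_thresholdDim {V : Type*} [Finite V] (G : SimpleGraph V) :
    G.HasThresholdCover G.thresholdDim := by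
  classical
  have key : ∀ x ∈ G.edgeSet, (SimpleGraph.fromEdgeSet {x}).IsThreshold := by
    intro x hx
    induction x with
    | _ a b =>
      have hab : a ≠ b := G.ne_of_adj hx
      refine ⟨2, fun v => if v = a ∨ v = b then 1 else 0, fun u v huv => ?_⟩
      simp only [SimpleGraph.fromEdgeSet_adj, Set.mem_singleton_iff, Sym2.eq_iff]
      by_cases h1 : u = a <;> by_cases h2 : u = b <;> by_cases h3 : v = a <;>
        by_cases h4 : v = b <;> simp_all <;> norm_num
  refine Nat.sInf_mem (s := {k : ℕ | G.HasThresholdCover k}) ?_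
  obtain ⟨k, ⟨e⟩⟩ := Finite.exists_equiv_fin G.edgeSet
  refine ⟨k, fun i => SimpleGraph.fromEdgeSet {(e.symm i : Sym2 V)},
    fun i => key _ (e.symm i).2, ?_⟩
  · ext x
    simp only [Set.mem_iUnion, SimpleGraph.edgeSet_fromEdgeSet, Set.mem_sdiff,
      Set.mem_singleton_iff]
    constructor
    · intro hx
      exact ⟨e ⟨x, hx⟩, by simp, G.not_isDiag_of_mem_edgeSet hx⟩
    · rintro ⟨i, rfl, -⟩
      exact (e.symm i).2

/-- The instances of the problem: co-bipartite graphs (graphs whose complement is bipartite) with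
vertex set `{0, …, n - 1}`. -/
structure CoBipartiteGraph where
  /-- the number of vertices -/
  order : ℕ
  /-- the graph -/
  graph : SimpleGraph (Fin order)
  /-- its complement is bipartite -/
  compl_isBipartite : graphᶜ.IsBipartite

open Classical in
/-- The input word of an instance: its adjacency matrix, row by row, as a word over the alphabet
`{some true, some false, none}`, where `none` marks the end of a row. -/
noncomputable def CoBipartiteGraph.encode (G : CoBipartiteGraph) : List (Option Bool) :=
  (List.finRange G.order).flatMap fun i =>
    ((List.finRange G.order).map fun j => some (decide (G.graph.Adj i j))) ++ [none]

/-!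
Cover the edges by threshold graphs that come from ranks on cliques of `G`, each edge being covered
from one of its endpoints. If the vertices are cut into blocks, then optimal rank covers of the
edges meeting each block together give a threshold cover. Within one block the optimum is at most
`2 t(G)`: a bipartition of `Gᶜ` splits the vertices into two cliques, and the weights of a threshold
subgraph, restricted to either clique, are a clique rank. Hence the sum of the optima approximates
`t(G)` within twice the number of blocks.

A block of `s` vertices needs at most `s` ranks, with values at most `s` on the block and `0`
elsewhere, so that `(s + 1) ^ s ^ 2` candidates suffice for an exhaustive search. The largest `s`
that keeps this number below `(n + 2) ^ 256` makes the search polynomial, and taking logarithms in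
`(n + 2) ^ 256 < (s + 2) ^ (s + 1) ^ 2` shows that there are at most `⌈n √(log log n) / √(log n)⌉`
blocks.

Polynomial time is established in a model of counter programs with an input tape and unary
registers. Functions computed by such programs in polynomial time are closed under composition and
polynomially bounded recursion, which yields bounded sums, quantifiers and searches; and each
program translates into a Turing machine with constant slowdown.
-/

/-! ### Rank covers -/

section RankCovers

open Finset

variable {V : Type*} {G : SimpleGraph V} {r : V → ℕ} {B : Set V} {k : ℕ} {u v : V}

/-- The vertices of positive rank form a clique. -/
def IsCliqueRank (G : SimpleGraph V) (r : V → ℕ) : Prop :=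
  G.IsClique {u | r u ≠ 0}

/-- The vertex `u` has positive rank, and every vertex of at least its rank is adjacent or equal to
`v`. -/
def RankCovers (G : SimpleGraph V) (r : V → ℕ) (u v : V) : Prop :=
  r u ≠ 0 ∧ ∀ x, r u ≤ r x → G.Adj x v ∨ x = v

/-- There are `k` clique ranks of `G` such that every edge with an endpoint in `B` is covered by one
of them from that endpoint. -/
def RankCoverable (G : SimpleGraph V) (B : Set V) (k : ℕ) : Prop :=
  ∃ r : Fin k → V → ℕ, (∀ j, IsCliqueRank G (r j)) ∧
    ∀ u ∈ B, ∀ v, G.Adj u v → ∃ j, RankCovers G (r j) u v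

/-- The least number of clique ranks needed to cover the edges with an endpoint in `B`. -/
noncomputable def rankCoverNumber (G : SimpleGraph V) (B : Set V) : ℕ :=
  sInf {k | RankCoverable G B k}

/-- The graph of the edges of `G` that are covered by `r` from one of their endpoints. -/
def rankGraph (G : SimpleGraph V) (r : V → ℕ) : SimpleGraph V where
  Adj u v := G.Adj u v ∧ (RankCovers G r u v ∨ RankCovers G r v u)
  symm := ⟨fun _ _ h => ⟨h.1.symm, h.2.symm⟩⟩
  loopless := ⟨fun _ h => h.1.ne rfl⟩

theorem exists_rankCovers_iff_le [Finite V] (G : SimpleGraph V) (r : V → ℕ) :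
    ∃ h : V → ℕ, (∀ v, h v ≠ 0) ∧ ∀ u v, RankCovers G r u v ↔ h v ≤ r u := by
  let levels (v : V) : Set ℕ := {k | k ≠ 0 ∧ ∀ x, k ≤ r x → G.Adj x v ∨ x = v}
  have nonempty (v : V) : (levels v).Nonempty := by
    obtain ⟨m, hm⟩ := (Set.finite_range r).bddAbove
    exact ⟨m + 1, m.succ_ne_zero, fun x hx => absurd (hm ⟨x, rfl⟩) (Nat.not_le.2 hx)⟩
  refine ⟨fun v => sInf (levels v), fun v => (Nat.sInf_mem (nonempty v)).1, fun u v =>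
    ⟨fun h => Nat.sInf_le h, fun h => ?_⟩⟩
  have ⟨pos, cover⟩ := Nat.sInf_mem (nonempty v)
  exact ⟨by dsimp only at h; omega, fun x hx => cover x (h.trans hx)⟩

theorem IsCliqueRank.rankCovers (hr : IsCliqueRank G r) (hu : r u ≠ 0) (hv : r v ≠ 0) :
    RankCovers G r u v :=
  ⟨hu, fun x hx => (eq_or_ne x v).symm.imp_left fun hxv =>
    hr (show r x ≠ 0 by omega) hv hxv⟩

theorem RankCovers.adj (h : RankCovers G r u v) (huv : u ≠ v) : G.Adj u v :=
  (h.2 u le_rfl).resolve_right huv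

theorem IsCliqueRank.isThreshold_rankGraph [Finite V] (hr : IsCliqueRank G r) :
    (rankGraph G r).IsThreshold := by
  obtain ⟨h, h_pos, cover_iff⟩ := exists_rankCovers_iff_le G r
  have adj_iff {u v : V} (huv : u ≠ v) :
      (rankGraph G r).Adj u v ↔ RankCovers G r u v ∨ RankCovers G r v u :=
    ⟨fun h => h.2, fun h => ⟨h.elim (·.adj huv) fun h => (h.adj huv.symm).symm, h⟩⟩
  refine ⟨0, fun v => if r v = 0 then -(h v : ℝ) else r v, fun u v huv => ?_⟩
  rw [adj_iff huv]
  have hu_pos : (0 : ℝ) < h u := mod_cast Nat.pos_of_ne_zero (h_pos u)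
  have hv_pos : (0 : ℝ) < h v := mod_cast Nat.pos_of_ne_zero (h_pos v)
  by_cases hu : r u = 0 <;> by_cases hv : r v = 0
  · have : ¬0 ≤ -(h u : ℝ) + -h v := by linarith
    simpa [hu, hv, cover_iff, h_pos] using this
  · simp [hu, hv, cover_iff, h_pos]
  · simp [hu, hv, cover_iff, h_pos]
  · simp only [hr.rankCovers hu hv, true_or, hu, hv, if_false, true_iff]
    positivity

theorem hasThresholdCover_card {ι : Type*} [Fintype ι] (T : ι → SimpleGraph V)
    (hT : ∀ i, (T i).IsThreshold) (hG : ∀ i, T i ≤ G)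
    (hc : ∀ u v, G.Adj u v → ∃ i, (T i).Adj u v) : G.HasThresholdCover (Fintype.card ι) := by
  refine ⟨fun i => T ((Fintype.equivFin ι).symm i), fun i => hT _, ?_⟩
  ext e
  induction e with
  | _ u v =>
    simp only [SimpleGraph.mem_edgeSet, Set.mem_iUnion, (Fintype.equivFin ι).symm.exists_congr_left]
    exact ⟨fun h => by simpa using hc u v h, fun ⟨i, hi⟩ => hG _ hi⟩

theorem rankCoverable_card {ι : Type*} [Fintype ι] (r : ι → V → ℕ)
    (hr : ∀ j, IsCliqueRank G (r j)) (hc : ∀ u ∈ B, ∀ v, G.Adj u v → ∃ j, RankCovers G (r j) u v) :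
    RankCoverable G B (Fintype.card ι) :=
  ⟨fun j => r ((Fintype.equivFin ι).symm j), fun _ => hr _, fun u hu v huv => by
    simpa [(Fintype.equivFin ι).symm.exists_congr_left] using hc u hu v huv⟩

theorem rankCoverable_card_self [Finite B] (G : SimpleGraph V) :
    RankCoverable G B (Nat.card B) := by
  classical
  have := Fintype.ofFinite B
  rw [Nat.card_eq_fintype_card]
  refine rankCoverable_card (fun b : B => Pi.single (b : V) 1) (fun b u hu v hv huv => ?_)
    fun u hu v huv => ⟨⟨u, hu⟩, by simp, fun x hx => ?_⟩
  · have hub : u = b := by simpa [Pi.single_apply] using hu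
    have hvb : v = b := by simpa [Pi.single_apply] using hv
    exact absurd (hub.trans hvb.symm) huv
  · have : x = u := by
      by_contra h
      simp [h] at hx
    exact .inl (this ▸ huv)

theorem rankCoverNumber_le_card [Finite B] (G : SimpleGraph V) :
    rankCoverNumber G B ≤ Nat.card B :=
  Nat.sInf_le (rankCoverable_card_self G)

theorem rankCoverable_rankCoverNumber [Finite B] (G : SimpleGraph V) :
    RankCoverable G B (rankCoverNumber G B) :=
  Nat.sInf_mem (s := {k | RankCoverable G B k}) ⟨_, rankCoverable_card_self G⟩

theorem thresholdDim_le_sum_rankCoverNumber [Finite V] {ι : Type*} [Fintype ι] {B : ι → Set V}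
    (hB : ∀ u, ∃ i, u ∈ B i) (G : SimpleGraph V) :
    G.thresholdDim ≤ ∑ i, rankCoverNumber G (B i) := by
  choose r hr hc using fun i => rankCoverable_rankCoverNumber (B := B i) G
  have cover := hasThresholdCover_card (ι := Σ i, Fin (rankCoverNumber G (B i)))
    (fun i => rankGraph G (r i.1 i.2)) (fun i => (hr _ _).isThreshold_rankGraph)
    (fun i u v h => h.1) fun u v huv => by
      obtain ⟨i, hi⟩ := hB u
      obtain ⟨j, hj⟩ := hc i u hi v huv
      exact ⟨⟨i, j⟩, huv, .inl hj⟩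
  exact (Nat.sInf_le (s := {k | G.HasThresholdCover k}) cover).trans_eq (by simp)

open Classical in
/-- The number of elements of `K` whose weight is at most that of `x`, if `x` belongs to `K`: ranks
with values up to `#K` that order `K` by weight and vanish outside. -/
noncomputable def rankOn {γ : Type*} [LinearOrder γ] (K : Finset V) (w : V → γ) (x : V) : ℕ :=
  if x ∈ K then #{y ∈ K | w y ≤ w x} else 0

section RankOn

variable {γ : Type*} [LinearOrder γ] {K : Finset V} {w : V → γ} {x y : V}

theorem rankOn_ne_zero_iff : rankOn K w x ≠ 0 ↔ x ∈ K := by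
  classical
  refine ⟨fun h => by_contra fun hx => h (if_neg hx), fun hx => ?_⟩
  rw [rankOn, if_pos hx]
  exact card_ne_zero_of_mem (mem_filter.2 ⟨hx, le_rfl⟩)

theorem rankOn_le_card (x : V) : rankOn K w x ≤ #K := by
  rw [rankOn]
  split_ifs
  exacts [card_filter_le _ _, Nat.zero_le _]

theorem le_of_rankOn_le (hx : x ∈ K) (h : rankOn K w x ≤ rankOn K w y) : y ∈ K ∧ w x ≤ w y := by
  classical
  have hy : y ∈ K := rankOn_ne_zero_iff.1
    ((Nat.pos_of_ne_zero (rankOn_ne_zero_iff.2 hx)).trans_le h).ne'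
  refine ⟨hy, le_of_not_gt fun hlt => h.not_gt ?_⟩
  rw [rankOn, rankOn, if_pos hx, if_pos hy]
  refine card_lt_card ⟨monotone_filter_right _ fun z _ hz => hz.trans hlt.le, fun hsub => ?_⟩
  exact hlt.not_ge (mem_filter.1 (hsub (mem_filter.2 ⟨hx, le_rfl⟩))).2

end RankOn

theorem RankCoverable.exists_le_card [Finite B] (h : RankCoverable G B k) :
    ∃ r : Fin k → V → ℕ, (∀ j x, r j x ≠ 0 → x ∈ B) ∧ (∀ j x, r j x ≤ Nat.card B) ∧
      (∀ j, IsCliqueRank G (r j)) ∧ ∀ u ∈ B, ∀ v, G.Adj u v → ∃ j, RankCovers G (r j) u v := by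
  classical
  have := Fintype.ofFinite B
  obtain ⟨r, hr, hc⟩ := h
  let K (j : Fin k) : Finset V := {x ∈ B.toFinset | r j x ≠ 0}
  have mem_K {j : Fin k} {x : V} : x ∈ K j ↔ x ∈ B ∧ r j x ≠ 0 := by simp [K]
  refine ⟨fun j => rankOn (K j) (r j), fun j x hx => (mem_K.1 (rankOn_ne_zero_iff.1 hx)).1,
    fun j x => (rankOn_le_card x).trans ?_, fun j u hu v hv huv => ?_, fun u hu v huv => ?_⟩
  · rw [Nat.card_eq_fintype_card, ← Set.toFinset_card]
    exact card_filter_le _ _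
  · exact hr j (mem_K.1 (rankOn_ne_zero_iff.1 hu)).2 (mem_K.1 (rankOn_ne_zero_iff.1 hv)).2 huv
  · obtain ⟨j, hj, cover⟩ := hc u hu v huv
    have huK : u ∈ K j := mem_K.2 ⟨hu, hj⟩
    exact ⟨j, rankOn_ne_zero_iff.2 huK, fun x hx => cover x (le_of_rankOn_le huK hx).2⟩

theorem rankCoverNumber_le_two_mul_thresholdDim [Finite V] (hG : Gᶜ.IsBipartite) (B : Set V) :
    rankCoverNumber G B ≤ 2 * G.thresholdDim := by
  classical
  have := Fintype.ofFinite V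
  obtain ⟨C⟩ := hG
  obtain ⟨T, hT, hE⟩ := G.hasThresholdCover_thresholdDim
  choose s w hw using hT
  have le_of_cover (i) : T i ≤ G := by
    rw [← SimpleGraph.edgeSet_subset_edgeSet, hE]
    exact Set.subset_iUnion (fun i => (T i).edgeSet) i
  have cover := rankCoverable_card (ι := Fin 2 × Fin G.thresholdDim) (G := G) (B := B)
    (fun i => rankOn {x | C x = i.1} (w i.2)) (fun i u hu v hv huv => ?_) fun u _ v huv => ?_
  · exact (Nat.sInf_le (s := {k | RankCoverable G B k}) cover).trans_eq (by simp)
  · have same : C u = C v := by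
      have hu := rankOn_ne_zero_iff.1 hu
      have hv := rankOn_ne_zero_iff.1 hv
      simp_all
    by_contra h
    exact C.valid ((SimpleGraph.compl_adj G u v).2 ⟨huv, h⟩) same
  · obtain ⟨i, hi⟩ : ∃ i, (T i).Adj u v := by
      simpa using hE.subset (G.mem_edgeSet.2 huv)
    have hu : u ∈ ({x | C x = C u} : Finset V) := by simp
    refine ⟨(C u, i), rankOn_ne_zero_iff.2 hu, fun x hx => (eq_or_ne x v).symm.imp_left
      fun hxv => le_of_cover i ((hw i x v hxv).2 ?_)⟩
    have := (le_of_rankOn_le hu hx).2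
    have := (hw i u v huv.ne).1 hi
    linarith

end RankCovers

/-! ### The algorithm -/

section Blocks

variable {n k s N : ℕ}

theorem exists_lt_pow_div_mod_eq {b m : ℕ} (f : ℕ → ℕ) (hf : ∀ i < m, f i < b) :
    ∃ c < b ^ m, ∀ i < m, c / b ^ i % b = f i := by
  let c : Fin (b ^ m) := finFunctionFinEquiv fun i => ⟨f i, hf i i.2⟩
  refine ⟨c, c.2, fun i hi => ?_⟩
  exact congrArg (fun g => ((g ⟨i, hi⟩ : Fin b) : ℕ)) (finFunctionFinEquiv.symm_apply_apply _)

/-- The `b`-th block of `s` consecutive vertices. -/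
def block (n s b : ℕ) : Set (Fin n) :=
  {u | u / s = b}

theorem card_block_le (hs : 0 < s) (n b : ℕ) : Nat.card (block n s b) ≤ s := by
  have inj : Function.Injective fun u : block n s b => (⟨u % s, Nat.mod_lt _ hs⟩ : Fin s) := by
    rintro ⟨u, hu⟩ ⟨v, hv⟩ h
    refine Subtype.ext (Fin.ext ?_)
    rw [← Nat.div_add_mod u s, ← Nat.div_add_mod v s, show (u : ℕ) / s = b from hu,
      show (v : ℕ) / s = b from hv, Fin.mk.inj h]
  simpa using Nat.card_le_card_of_injective _ inj

/-- The ranks on block `b` encoded by `c`: the rank of the `i`-th vertex of the block with respect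
to the `j`-th clique rank is the digit number `j * s + i` of `c` in base `s + 1`. -/
def codedRank (s b c j x : ℕ) : ℕ :=
  if x / s = b then c / (s + 1) ^ (j * s + x % s) % (s + 1) else 0

/-- The first `k` ranks encoded by `c` are clique ranks that cover all edges with an endpoint in
block `b`. -/
def IsCodedCover (G : SimpleGraph (Fin n)) (s b k c : ℕ) : Prop :=
  (∀ j < k, IsCliqueRank G fun x => codedRank s b c j x) ∧
    ∀ u ∈ block n s b, ∀ v, G.Adj u v → ∃ j < k, RankCovers G (fun x => codedRank s b c j x) u v

theorem IsCodedCover.rankCoverable {G : SimpleGraph (Fin n)} {b c : ℕ}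
    (h : IsCodedCover G s b k c) : RankCoverable G (block n s b) k :=
  ⟨fun j x => codedRank s b c j x, fun j => h.1 j j.2, fun u hu v huv =>
    let ⟨j, hj, cover⟩ := h.2 u hu v huv
    ⟨⟨j, hj⟩, cover⟩⟩

theorem exists_codedRank_eq {b : ℕ} (hs : 0 < s) (hk : k ≤ s) (r : Fin k → Fin n → ℕ)
    (support : ∀ j x, r j x ≠ 0 → x ∈ block n s b) (bound : ∀ j x, r j x ≤ s) :
    ∃ c < (s + 1) ^ s ^ 2, ∀ (j : Fin k) (x : Fin n), codedRank s b c j x = r j x := by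
  obtain ⟨c, hc, digit⟩ := exists_lt_pow_div_mod_eq (b := s + 1) (m := s ^ 2)
    (fun i => if h : i / s < k ∧ b * s + i % s < n then r ⟨i / s, h.1⟩ ⟨b * s + i % s, h.2⟩ else 0)
    fun i _ => by
      split_ifs
      exacts [Nat.lt_succ_of_le (bound _ _), s.succ_pos]
  refine ⟨c, hc, fun j x => ?_⟩
  by_cases hx : x / s = b
  · have hlt : j * s + x % s < s ^ 2 := by
      have := Nat.mod_lt x hs
      nlinarith [j.2]
    have hj : (j * s + x % s) / s = j := by
      rw [mul_comm, Nat.mul_add_div hs, Nat.div_eq_of_lt (Nat.mod_lt _ hs), add_zero]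
    have hx' : b * s + x % s = x := hx ▸ Nat.div_add_mod' _ _
    simp [codedRank, hx, digit _ hlt, hj, hx']
  · rw [codedRank, if_neg hx]
    exact (not_imp_comm.1 (support j x) hx).symm

theorem isLeast_rankCoverNumber_block (hs : 0 < s) (hN : (s + 1) ^ s ^ 2 ≤ N)
    (G : SimpleGraph (Fin n)) (b : ℕ) :
    IsLeast {k | k = s ∨ ∃ c < N, IsCodedCover G s b k c} (rankCoverNumber G (block n s b)) := by
  have le_size := (rankCoverNumber_le_card (B := block n s b) G).trans (card_block_le hs n b)
  refine ⟨.inr ?_, ?_⟩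
  · obtain ⟨r, support, bound, clique, cover⟩ :=
      (rankCoverable_rankCoverNumber (B := block n s b) G).exists_le_card
    obtain ⟨c, hc, code⟩ := exists_codedRank_eq hs le_size r support
      fun j x => (bound j x).trans (card_block_le hs n b)
    refine ⟨c, hc.trans_le hN, fun j hj => ?_, fun u hu v huv => ?_⟩
    · exact (funext (code ⟨j, hj⟩) : _ = r ⟨j, hj⟩) ▸ clique ⟨j, hj⟩
    · obtain ⟨j, hj⟩ := cover u hu v huv
      exact ⟨j, j.2, (funext (code j) : _ = r j) ▸ hj⟩
  · rintro k (rfl | ⟨c, -, hc⟩)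
    · exact le_size
    · exact Nat.sInf_le (s := {k | RankCoverable G (block n s b) k}) hc.rankCoverable

/-- The size of the blocks: the largest `s` with `(s + 1) ^ s ^ 2 ≤ (n + 2) ^ 256`, or `n + 1` if
that is smaller. -/
noncomputable def blockSize (n : ℕ) : ℕ :=
  sInf {s | s = n + 1 ∨ (n + 2) ^ 256 < (s + 2) ^ (s + 1) ^ 2}

theorem blockSize_spec (n : ℕ) :
    blockSize n = n + 1 ∨ (n + 2) ^ 256 < (blockSize n + 2) ^ (blockSize n + 1) ^ 2 :=
  Nat.sInf_mem (s := {s | s = n + 1 ∨ (n + 2) ^ 256 < (s + 2) ^ (s + 1) ^ 2}) ⟨n + 1, .inl rfl⟩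

theorem blockSize_pos (n : ℕ) : 0 < blockSize n := by
  refine Nat.pos_of_ne_zero fun h => ?_
  have le_pow : n + 2 ≤ (n + 2) ^ 256 := Nat.le_self_pow (by simp) _
  rcases h ▸ blockSize_spec n with h | h
  · exact n.succ_ne_zero h.symm
  · exact (h.trans_le (by simp)).not_ge le_pow

theorem pow_blockSize_le (n : ℕ) :
    (blockSize n + 1) ^ blockSize n ^ 2 ≤ (n + 2) ^ 256 := by
  obtain ⟨s, hs⟩ := Nat.exists_eq_succ_of_ne_zero (blockSize_pos n).ne'
  rw [hs]
  by_contra! h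
  have : blockSize n ≤ s := Nat.sInf_le (.inr h)
  omega

theorem isLeast_blockSize (n : ℕ) :
    IsLeast {s | s = n + 1 ∨ (n + 2) ^ 256 < (s + 2) ^ (s + 1) ^ 2} (blockSize n) :=
  ⟨blockSize_spec n, fun _ h => Nat.sInf_le h⟩

/-- The sum over all blocks of `s` consecutive vertices of the least number of clique ranks that
cover the edges meeting the block: the value returned by the algorithm. -/
noncomputable def blockRankCoverSum (G : SimpleGraph (Fin n)) (s : ℕ) : ℕ :=
  ∑ b ∈ Finset.range (n ⌈/⌉ s), rankCoverNumber G (block n s b)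

theorem thresholdDim_le_blockRankCoverSum (hs : 0 < s) (G : SimpleGraph (Fin n)) :
    G.thresholdDim ≤ blockRankCoverSum G s := by
  rw [blockRankCoverSum, Finset.sum_range]
  refine thresholdDim_le_sum_rankCoverNumber (fun u => ?_) G
  exact ⟨⟨u / s, Nat.div_lt_of_lt_mul (u.2.trans_le (le_smul_ceilDiv hs))⟩, rfl⟩

theorem blockRankCoverSum_le {G : SimpleGraph (Fin n)} (hG : Gᶜ.IsBipartite) (hs : 0 < s) {m : ℕ}
    (hm : n ≤ s * m) : blockRankCoverSum G s ≤ 2 * m * G.thresholdDim :=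
  calc blockRankCoverSum G s
      ≤ n ⌈/⌉ s * (2 * G.thresholdDim) := by
        simpa [blockRankCoverSum] using Finset.sum_le_card_nsmul (Finset.range (n ⌈/⌉ s)) _ _
          fun b _ => rankCoverNumber_le_two_mul_thresholdDim hG (block n s b)
    _ ≤ m * (2 * G.thresholdDim) := by
        gcongr
        exact (ceilDiv_le_iff_le_mul hs).2 hm
    _ = 2 * m * G.thresholdDim := by ring

end Blocks

/-! ### The approximation factor -/

section Factor

open Real

theorem le_sq_mul_log {x s : ℝ} (hx : 1.05 ≤ x) (hs : 1 ≤ s)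
    (h : 256 * x < (s + 1) ^ 2 * log (s + 2)) : x ≤ s ^ 2 * log x := by
  have hx₀ : 0 < x := by linarith
  have hy : 0.04 ≤ log x := by
    have h_inv : x⁻¹ ≤ 1.05⁻¹ := by gcongr
    norm_num at h_inv
    linarith [one_sub_inv_le_log_of_pos hx₀]
  by_contra! hlt
  have h_log : 64 * log x < log (s + 2) := by
    have hl : 0 < log (s + 2) := log_pos (by linarith)
    refine lt_of_mul_lt_mul_left (a := 4 * x) ?_ (by linarith)
    calc 4 * x * (64 * log x) = 256 * x * log x := by ring
      _ < (s + 1) ^ 2 * log (s + 2) * log x := by gcongr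
      _ ≤ 4 * s ^ 2 * log (s + 2) * log x := by gcongr; nlinarith
      _ = 4 * (s ^ 2 * log x) * log (s + 2) := by ring
      _ ≤ 4 * x * log (s + 2) := by gcongr
  have h_pow : x ^ 64 < 3 * s := by
    have : x ^ 64 < s + 2 := (log_lt_log_iff (by positivity) (by positivity)).1 <| by
      rw [log_pow]
      exact_mod_cast h_log
    linarith
  have h_lt : x ^ 127 * log x < 9 := by
    refine lt_of_mul_lt_mul_left (a := x) ?_ hx₀.le
    calc x * (x ^ 127 * log x) = (x ^ 64) ^ 2 * log x := by ring
      _ ≤ (3 * s) ^ 2 * log x := by gcongr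
      _ = 9 * (s ^ 2 * log x) := by ring
      _ < x * 9 := by linarith
  have h_ge : (1.05 : ℝ) ^ 127 * 0.04 ≤ x ^ 127 * log x := by gcongr
  norm_num at h_ge h_lt
  linarith

theorem one_oh_five_le_log {n : ℕ} (hn : 3 ≤ n) : 1.05 ≤ log n := by
  have : log 3 ≤ log n := log_le_log (by norm_num) (by exact_mod_cast hn)
  linarith [log_three_gt_d9]

theorem le_mul_sqrt_log_log_div_sqrt_log {n s : ℕ} (hn : 3 ≤ n) (hs : 0 < s)
    (h : n ^ 256 < (s + 2) ^ (s + 1) ^ 2) :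
    (n : ℝ) ≤ s * (n * √(log (log n)) / √(log n)) := by
  have hx := one_oh_five_le_log hn
  have h_log : 256 * log n < (s + 1) ^ 2 * log (s + 2) := by
    have h_cast : (n : ℝ) ^ 256 < ((s : ℝ) + 2) ^ (s + 1) ^ 2 := by exact_mod_cast h
    have := log_lt_log (by positivity) h_cast
    rw [log_pow, log_pow] at this
    exact_mod_cast this
  have h_sqrt : √(log n) ≤ s * √(log (log n)) := by
    rw [← sqrt_sq (by positivity : (0 : ℝ) ≤ s), ← sqrt_mul (by positivity)]
    exact sqrt_le_sqrt (le_sq_mul_log hx (by exact_mod_cast hs) h_log)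
  rw [← mul_div_assoc, le_div_iff₀ (sqrt_pos.2 (by linarith))]
  calc (n : ℝ) * √(log n) ≤ n * (s * √(log (log n))) := by gcongr
    _ = s * (n * √(log (log n))) := by ring

theorem le_blockSize_mul_ceil {n : ℕ} (hn : 3 ≤ n) :
    n ≤ blockSize n * ⌈(n : ℝ) * √(log (log n)) / √(log n)⌉₊ := by
  rcases blockSize_spec n with h | h
  · have hx := one_oh_five_le_log hn
    have : 0 < log (log n) := log_pos (by linarith)
    rw [h]
    exact n.le_succ.trans (Nat.le_mul_of_pos_right _ (Nat.ceil_pos.2 (by positivity)))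
  · have h_real := le_mul_sqrt_log_log_div_sqrt_log hn (blockSize_pos n)
      ((Nat.pow_lt_pow_left (by omega) (by norm_num)).trans h)
    have h_ceil := h_real.trans (mul_le_mul_of_nonneg_left (Nat.le_ceil _) (Nat.cast_nonneg _))
    exact_mod_cast h_ceil

end Factor

/-! ### The adjacency matrix -/

theorem getElem?_flatMap_of_length_eq {α β : Type*} (f : α → List β) (m : ℕ) (l : List α)
    (h : ∀ x ∈ l, (f x).length = m) (i : ℕ) {j : ℕ} (hj : j < m) :
    (l.flatMap f)[i * m + j]? = l[i]?.bind fun x => (f x)[j]? := by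
  induction l generalizing i with
  | nil => simp
  | cons x l ih =>
    have hx := h x (by simp)
    rw [List.flatMap_cons]
    rcases i with _ | i
    · rw [List.getElem?_append_left (by omega)]
      simp
    · rw [List.getElem?_append_right (by rw [hx, Nat.succ_mul]; omega)]
      have : (i + 1) * m + j - (f x).length = i * m + j := by rw [hx, Nat.succ_mul]; omega
      rw [this, ih fun y hy => h y (by simp [hy])]
      simp

namespace CoBipartiteGraph

theorem length_encode (G : CoBipartiteGraph) : G.encode.length = G.order * (G.order + 1) := by
  simp [encode, List.length_flatMap]

theorem isLeast_order (G : CoBipartiteGraph) :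
    IsLeast {n | n = G.encode.length ∨ G.encode.length ≤ n * (n + 1)} G.order := by
  refine ⟨.inr G.length_encode.le, ?_⟩
  rintro n (rfl | h) <;> rw [length_encode] at *
  · exact Nat.le_mul_of_pos_right _ G.order.succ_pos
  · by_contra! hlt
    nlinarith

theorem getElem?_encode (G : CoBipartiteGraph) (u : ℕ) {v : ℕ} (hv : v < G.order) :
    G.encode[u * (G.order + 1) + v]? = some (some true) ↔
      ∃ hu : u < G.order, G.graph.Adj ⟨u, hu⟩ ⟨v, hv⟩ := by
  classical
  rw [encode, getElem?_flatMap_of_length_eq _ (G.order + 1) _ (by simp) _ (by omega)]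
  by_cases hu : u < G.order
  · simp [hu, hv, List.getElem?_append_left]
  · simp [hu]

end CoBipartiteGraph

/-! ### Counter programs -/

namespace CounterProgram

/-- The memory of a counter program: natural-number registers, an input tape split at the head into
the part ahead of the head and the (reversed) part behind it, and an output stack. -/
structure Store where
  regs : ℕ → ℕ
  ahead : List (Option Bool)
  behind : List (Option Bool)
  out : List Bool

/-- The atomic actions of counter programs: `advance` and `retreat` move the head, `discard` deletes
the symbol ahead, `scan r` increments register `r` if the symbol ahead is `some true`. -/
inductive Action
  | inc (r : ℕ)
  | dec (r : ℕ)
  | advance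
  | retreat
  | discard
  | scan (r : ℕ)
  | pushOut (b : Bool)
  | popOut

/-- The tests that guard the loops of counter programs: register `r` is positive, the tape ahead
or behind is nonempty, the top of the output stack is `true`. -/
inductive Test
  | pos (r : ℕ)
  | ahead
  | behind
  | outTrue

/-- The store after an action. -/
def Action.apply : Action → Store → Store
  | inc r, s => { s with regs := Function.update s.regs r (s.regs r + 1) }
  | dec r, s => { s with regs := Function.update s.regs r (s.regs r - 1) }
  | advance, s => { s with ahead := s.ahead.tail, behind := s.ahead.head?.toList ++ s.behind }
  | retreat, s => { s with behind := s.behind.tail, ahead := s.behind.head?.toList ++ s.ahead }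
  | discard, s => { s with ahead := s.ahead.tail }
  | scan r, s =>
    if s.ahead.head? = some (some true) then
      { s with regs := Function.update s.regs r (s.regs r + 1) } else s
  | pushOut b, s => { s with out := b :: s.out }
  | popOut, s => { s with out := s.out.tail }

/-- The outcome of a test. -/
def Test.holds : Test → Store → Bool
  | pos r, s => s.regs r ≠ 0
  | ahead, s => s.ahead ≠ []
  | behind, s => s.behind ≠ []
  | outTrue, s => s.out.head? = some true

end CounterProgram

/-- While programs on counters, with a read-only input tape and an output stack. They are the
intermediate language between arithmetic functions and Turing machines. -/
inductive CounterProgram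
  | act (a : CounterProgram.Action)
  | seq (p q : CounterProgram)
  | whl (b : CounterProgram.Test) (p : CounterProgram)

namespace CounterProgram

/-- `Run p s t s'`: started in the store `s`, the program `p` stops in the store `s'` after at most
`t` steps. -/
inductive Run : CounterProgram → Store → ℕ → Store → Prop
  | act (a : Action) (s : Store) : Run (.act a) s 1 (a.apply s)
  | seq {p q : CounterProgram} {s s' s'' : Store} {t t' : ℕ} :
      Run p s t s' → Run q s' t' s'' → Run (.seq p q) s (t + t') s''
  | ended {b : Test} {p : CounterProgram} {s : Store} : b.holds s = false → Run (.whl b p) s 1 s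
  | loop {b : Test} {p : CounterProgram} {s s' s'' : Store} {t t' : ℕ} : b.holds s = true →
      Run p s t s' → Run (.whl b p) s' t' s'' → Run (.whl b p) s (1 + t + t') s''
  | mono {p : CounterProgram} {s s' : Store} {t t' : ℕ} : Run p s t s' → t ≤ t' → Run p s t' s'

/-! ### Compilation to stack machines -/

/-- The stacks of the machine that simulates a program whose registers are below `m`. -/
inductive Tape (m : ℕ)
  | ahead
  | behind
  | out
  | reg (r : Fin m)
  deriving DecidableEq, Fintype

/-- The stack alphabets; registers are kept in unary. -/
abbrev Tape.Alphabet {m : ℕ} : Tape m → Type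
  | ahead => Option Bool
  | behind => Option Bool
  | out => Bool
  | reg _ => Unit

/-- The stacks that represent a store. -/
def Store.tapes {m : ℕ} (s : Store) : ∀ k : Tape m, List k.Alphabet
  | .ahead => s.ahead
  | .behind => s.behind
  | .out => s.out
  | .reg r => List.replicate (s.regs r) ()

section Tapes

variable {m : ℕ} (s : Store)

theorem Store.tapes_regs_update (r : Fin m) (x : ℕ) :
    ({ s with regs := Function.update s.regs r x } : Store).tapes =
      Function.update s.tapes (Tape.reg r) (List.replicate x ()) := by
  funext k
  cases k with
  | reg i => obtain rfl | h := eq_or_ne i r <;> simp [tapes, Fin.val_inj, *]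
  | _ => simp [tapes]

theorem Store.tapes_ahead_eq (l : List (Option Bool)) :
    ({ s with ahead := l } : Store).tapes = Function.update s.tapes (.ahead : Tape m) l := by
  funext k
  cases k <;> simp [tapes]

theorem Store.tapes_behind_eq (l : List (Option Bool)) :
    ({ s with behind := l } : Store).tapes = Function.update s.tapes (.behind : Tape m) l := by
  funext k
  cases k <;> simp [tapes]

theorem Store.tapes_out_eq (l : List Bool) :
    ({ s with out := l } : Store).tapes = Function.update s.tapes (.out : Tape m) l := by
  funext k
  cases k <;> simp [tapes]

end Tapes

/-- A bound for the registers of an action. -/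
def Action.width : Action → ℕ
  | inc r | dec r | scan r => r + 1
  | _ => 0

/-- A bound for the registers of a test. -/
def Test.width : Test → ℕ
  | pos r => r + 1
  | _ => 0

/-- A bound for the registers of a program. -/
def width : CounterProgram → ℕ
  | act a => a.width
  | seq p q => max p.width q.width
  | whl b p => max b.width p.width

/-- Statements of the simulating machine. Its internal state only buffers one symbol. -/
abbrev Statement (m : ℕ) (Λ : Type) : Type :=
  Turing.TM2.Stmt (Tape.Alphabet (m := m)) Λ (Option (Option Bool))

open Turing.TM2.Stmt in
/-- The statement that performs an action and goes to `e`. -/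
def Action.code {m : ℕ} {Λ : Type} (e : Λ) : Action → Statement m Λ
  | inc r => if h : r < m then push (.reg ⟨r, h⟩) (fun _ => ()) (goto fun _ => e) else halt
  | dec r => if h : r < m then pop (.reg ⟨r, h⟩) (fun x _ => x) (goto fun _ => e) else halt
  | advance => pop .ahead (fun _ x => x) <| branch Option.isSome
      (push .behind (fun x => x.getD none) <| load (fun _ => none) <| goto fun _ => e)
      (goto fun _ => e)
  | retreat => pop .behind (fun _ x => x) <| branch Option.isSome
      (push .ahead (fun x => x.getD none) <| load (fun _ => none) <| goto fun _ => e)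
      (goto fun _ => e)
  | discard => pop .ahead (fun x _ => x) (goto fun _ => e)
  | scan r => if h : r < m then
      peek .ahead (fun _ x => x) <| branch (fun x => x = some (some true))
        (push (.reg ⟨r, h⟩) (fun _ => ()) <| load (fun _ => none) <| goto fun _ => e)
        (load (fun _ => none) <| goto fun _ => e) else halt
  | pushOut b => push .out (fun _ => b) (goto fun _ => e)
  | popOut => pop .out (fun x _ => x) (goto fun _ => e)

open Turing.TM2.Stmt in
/-- The statement that goes to `y` or `n` according to the outcome of a test. -/
def Test.code {m : ℕ} {Λ : Type} (y n : Λ) : Test → Statement m Λ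
  | pos r => if h : r < m then peek (.reg ⟨r, h⟩) (fun _ x => x.map fun _ => none) <|
      branch Option.isSome (load (fun _ => none) <| goto fun _ => y) (goto fun _ => n) else halt
  | ahead => peek .ahead (fun _ x => x.map fun _ => none) <|
      branch Option.isSome (load (fun _ => none) <| goto fun _ => y) (goto fun _ => n)
  | behind => peek .behind (fun _ x => x.map fun _ => none) <|
      branch Option.isSome (load (fun _ => none) <| goto fun _ => y) (goto fun _ => n)
  | outTrue => peek .out (fun _ x => if x = some true then some none else none) <|
      branch Option.isSome (load (fun _ => none) <| goto fun _ => y) (goto fun _ => n)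

theorem Action.stepAux_code {m : ℕ} {Λ : Type} (e : Λ) (a : Action) (ha : a.width ≤ m)
    (s : Store) :
    Turing.TM2.stepAux (a.code e : Statement m Λ) none s.tapes =
      ⟨some e, none, (a.apply s).tapes⟩ := by
  obtain ⟨regs, ahead, behind, out⟩ := s
  cases a with
  | inc r =>
    have := Store.tapes_regs_update ⟨regs, ahead, behind, out⟩ (⟨r, ha⟩ : Fin m) (regs r + 1)
    simp_all [code, apply, Store.tapes, Nat.lt_of_succ_le ha, List.replicate_succ]
  | dec r =>
    have := Store.tapes_regs_update ⟨regs, ahead, behind, out⟩ (⟨r, ha⟩ : Fin m) (regs r - 1)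
    simp_all [code, apply, Store.tapes, Nat.lt_of_succ_le ha]
  | scan r =>
    have := Store.tapes_regs_update ⟨regs, ahead, behind, out⟩ (⟨r, ha⟩ : Fin m) (regs r + 1)
    by_cases h : ahead.head? = some (some true) <;>
      simp_all [code, apply, Store.tapes, Nat.lt_of_succ_le ha, List.replicate_succ]
  | advance =>
    cases ahead <;>
      simp [code, apply, Store.tapes, ← Store.tapes_ahead_eq, ← Store.tapes_behind_eq]
  | retreat =>
    cases behind <;>
      simp [code, apply, Store.tapes, ← Store.tapes_ahead_eq, ← Store.tapes_behind_eq]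
  | discard => simp [code, apply, Store.tapes, ← Store.tapes_ahead_eq]
  | pushOut b => simp [code, apply, Store.tapes, ← Store.tapes_out_eq]
  | popOut => simp [code, apply, Store.tapes, ← Store.tapes_out_eq]

theorem Test.stepAux_code {m : ℕ} {Λ : Type} (y n : Λ) (b : Test) (hb : b.width ≤ m) (s : Store) :
    Turing.TM2.stepAux (b.code y n : Statement m Λ) none s.tapes =
      ⟨some (if b.holds s then y else n), none, s.tapes⟩ := by
  obtain ⟨regs, ahead, behind, out⟩ := s
  cases b with
  | pos r =>
    rcases h : regs r <;>
      simp [code, Nat.lt_of_succ_le hb, Store.tapes, holds, h, List.replicate_succ]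
  | ahead => cases ahead <;> simp [code, Store.tapes, holds]
  | behind => cases behind <;> simp [code, Store.tapes, holds]
  | outTrue => by_cases h : out.head? = some true <;> simp [code, Store.tapes, holds, h]

/-- The control positions inside a program. -/
def Position : CounterProgram → Type
  | act _ => Unit
  | seq p q => p.Position ⊕ q.Position
  | whl _ p => Option p.Position

instance finite_position (p : CounterProgram) : Finite p.Position := by
  induction p with
  | act a => exact inferInstanceAs (Finite Unit)
  | seq p q _ _ => exact inferInstanceAs (Finite (p.Position ⊕ q.Position))
  | whl b p _ => exact inferInstanceAs (Finite (Option p.Position))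

/-- The first control position of a program. -/
def entry : (p : CounterProgram) → p.Position
  | act _ => ()
  | seq p _ => Sum.inl p.entry
  | whl _ _ => none

/-- The statement at a control position of a program whose positions are embedded in the labels by
`i` and that goes to the label `e` in the end. -/
def code {Λ : Type} (m : ℕ) : (p : CounterProgram) → (p.Position → Λ) → Λ → p.Position →
    Statement m Λ
  | act a, _, e, _ => a.code e
  | seq p q, i, _, .inl x => p.code m (i ∘ Sum.inl) (i (Sum.inr q.entry)) x
  | seq _ q, i, e, .inr x => q.code m (i ∘ Sum.inr) e x
  | whl b p, i, e, none => b.code (i (some p.entry)) e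
  | whl _ p, i, _, some x => p.code m (i ∘ some) (i none) x

/-- The machine `M` reaches label `l'` with the stacks of `s'` from label `l` with the stacks of
`s` within `t` steps. -/
def Simulates {m : ℕ} {Λ : Type} (M : Λ → Statement m Λ) (l : Λ) (s : Store) (t : ℕ) (l' : Λ)
    (s' : Store) : Prop :=
  Nonempty (StateTransition.EvalsToInTime (Turing.TM2.step M) ⟨some l, none, s.tapes⟩
    (some ⟨some l', none, s'.tapes⟩) t)

section Simulates

variable {m : ℕ} {Λ : Type} {M : Λ → Statement m Λ} {l l' l'' : Λ} {s s' s'' : Store} {t t' : ℕ}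

theorem Simulates.of_stepAux
    (h : Turing.TM2.stepAux (M l) none s.tapes = ⟨some l', none, s'.tapes⟩) :
    Simulates M l s 1 l' s' :=
  ⟨⟨1, by simp [flip, Turing.TM2.step, h]⟩, le_rfl⟩

theorem Simulates.trans (h : Simulates M l s t l' s') (h' : Simulates M l' s' t' l'' s'') :
    Simulates M l s (t + t') l'' s'' :=
  h.elim fun e => h'.elim fun e' => ⟨add_comm t t' ▸ e.trans _ _ _ _ _ _ e'⟩

theorem Simulates.mono (h : Simulates M l s t l' s') (ht : t ≤ t') : Simulates M l s t' l' s' :=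
  h.elim fun e => ⟨e.toEvalsTo, e.steps_le_m.trans ht⟩

end Simulates

theorem Run.simulates {Λ : Type} {m : ℕ} {M : Λ → Statement m Λ} {p : CounterProgram}
    {s s' : Store} {t : ℕ} (h : Run p s t s') (hp : p.width ≤ m) {i : p.Position → Λ} {e : Λ}
    (hM : ∀ x, M (i x) = p.code m i e x) : Simulates M (i p.entry) s t e s' := by
  induction h generalizing e with
  | act a s => exact .of_stepAux (hM () ▸ a.stepAux_code e hp s)
  | @seq p q s s' s'' t t' _ _ ihp ihq =>
    rw [width, max_le_iff] at hp
    exact (ihp hp.1 (i := i ∘ Sum.inl) fun x => hM (Sum.inl x)).trans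
      (ihq hp.2 (i := i ∘ Sum.inr) fun x => hM (Sum.inr x))
  | @ended b p s hb =>
    rw [width, max_le_iff] at hp
    exact .of_stepAux ((congrArg (Turing.TM2.stepAux · none s.tapes) (hM none)).trans
      ((b.stepAux_code _ e hp.1 s).trans (by simp [hb])))
  | @loop b p s s' s'' t t' hb _ _ ihp ihw =>
    have hw := hp
    rw [width, max_le_iff] at hp
    have enter : Simulates M (i none) s 1 (i (some p.entry)) s :=
      .of_stepAux ((congrArg (Turing.TM2.stepAux · none s.tapes) (hM none)).trans
        ((b.stepAux_code _ e hp.1 s).trans (by simp [hb])))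
    exact (enter.trans (ihp hp.2 (i := i ∘ some) fun x => hM (some x))).trans (ihw hw hM)
  | mono _ ht ih => exact (ih hp hM).mono ht

open Classical in
/-- The stack machine that runs a program; its label `none` halts. -/
noncomputable def machine (p : CounterProgram) : Turing.FinTM2 where
  K := Tape p.width
  k₀ := .ahead
  k₁ := .out
  Γ := Tape.Alphabet
  Λ := Option p.Position
  main := some p.entry
  ΛFin := Fintype.ofFinite _
  σ := Option (Option Bool)
  initialState := none
  m
    | none => Turing.TM2.Stmt.halt
    | some x => p.code p.width some none x

theorem initList_machine (p : CounterProgram) (w : List (Option Bool)) :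
    Turing.initList p.machine w =
      ⟨some (some p.entry), none, Store.tapes ⟨fun _ => 0, w, [], []⟩⟩ := by
  refine congrArg (Turing.TM2.Cfg.mk (some (some p.entry)) none) (funext fun k => ?_)
  cases k <;> rfl

theorem haltList_machine (p : CounterProgram) (w : List Bool) :
    Turing.haltList p.machine w = ⟨none, none, Store.tapes ⟨fun _ => 0, [], [], w⟩⟩ := by
  refine congrArg (Turing.TM2.Cfg.mk none none) (funext fun k => ?_)
  cases k <;> rfl

theorem nonempty_tm2ComputableInPolyTime {α : Type} {ea : α → List (Option Bool)}
    {eb : ℕ → List Bool} {f : α → ℕ} (p : CounterProgram) (T : Polynomial ℕ)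
    (h : ∀ a, Run p ⟨fun _ => 0, ea a, [], []⟩ (T.eval (ea a).length)
      ⟨fun _ => 0, [], [], eb (f a)⟩) :
    Nonempty (Turing.TM2ComputableInPolyTime ea eb f) := by
  refine ⟨{
    tm := p.machine
    inputAlphabet := Equiv.refl _
    outputAlphabet := Equiv.refl _
    time := T + 1
    outputsFun := fun a => Classical.choice ?_ }⟩
  obtain ⟨run⟩ : Simulates p.machine.m (some p.entry) _ _ none _ :=
    (h a).simulates le_rfl fun _ => rfl
  have halt : StateTransition.EvalsToInTime (Turing.TM2.step p.machine.m)
      ⟨some none, none, Store.tapes ⟨fun _ => 0, [], [], eb (f a)⟩⟩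
      (some ⟨none, none, Store.tapes ⟨fun _ => 0, [], [], eb (f a)⟩⟩) 1 := ⟨⟨1, rfl⟩, le_rfl⟩
  obtain ⟨⟨k, hk⟩, hkT⟩ := run.trans _ _ _ _ _ _ halt
  have start := (congrArg (Turing.initList p.machine) (List.map_id (ea a))).trans
    (initList_machine p (ea a))
  have halted := (congrArg (Turing.haltList p.machine) (List.map_id (eb (f a)))).trans
    (haltList_machine p (eb (f a)))
  exact ⟨⟨k, ((congrArg _ (congrArg some start)).trans hk).trans (congrArg some halted).symm⟩,
    by simpa [add_comm] using hkT⟩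

/-! ### Elementary programs -/

section Programs

open Function

theorem Run.cast {p : CounterProgram} {s₀ s s' s'' : Store} {t t' : ℕ} (h : Run p s₀ t s')
    (hs₀ : s₀ = s) (hs : s' = s'') (ht : t ≤ t') : Run p s t' s'' :=
  hs₀ ▸ hs ▸ h.mono ht

theorem Store.mk_congr {r r' : ℕ → ℕ} {u v : List (Option Bool)} {o : List Bool}
    (h : ∀ j, r j = r' j) : Store.mk r u v o = ⟨r', u, v, o⟩ := by
  rw [funext h]

theorem run_whl {b : Test} {p : CounterProgram} (t c : ℕ) (S : ℕ → Store)
    (body : ∀ i < c, b.holds (S i) = true ∧ Run p (S i) t (S (i + 1)))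
    (exit : b.holds (S c) = false) : Run (.whl b p) (S 0) (c * (t + 1) + 1) (S c) := by
  induction c generalizing S with
  | zero => simpa using Run.ended exit
  | succ c ih =>
    refine (Run.loop (body 0 c.succ_pos).1 (body 0 c.succ_pos).2
      (ih (fun i => S (i + 1)) (fun i hi => body (i + 1) (by omega)) exit)).mono ?_
    rw [Nat.succ_mul]
    omega

theorem run_countdown {a : ℕ} {p : CounterProgram} (t c : ℕ) (S : ℕ → Store)
    (counter : ∀ i ≤ c, (S i).regs a = c - i) (body : ∀ i < c, Run p (S i) t (S (i + 1))) :
    Run (.whl (.pos a) p) (S 0) (c * (t + 1) + 1) (S c) := by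
  refine run_whl t c S (fun i hi => ⟨?_, body i hi⟩) (by simp [Test.holds, counter])
  simp only [Test.holds, counter i hi.le, decide_eq_true_eq]
  omega

variable (r : ℕ → ℕ) (u v : List (Option Bool)) (o : List Bool)

/-- The program that sets register `a` to `0`. -/
def clear (a : ℕ) : CounterProgram :=
  whl (.pos a) (act (.dec a))

/-- The program that adds register `a` to register `b` and clears `a`. -/
def move (a b : ℕ) : CounterProgram :=
  whl (.pos a) (seq (act (.dec a)) (act (.inc b)))

/-- The program that adds register `a` to register `b`, with register `c` as scratch memory. -/
def copy (a b c : ℕ) : CounterProgram :=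
  seq (whl (.pos a) (seq (act (.dec a)) (seq (act (.inc b)) (act (.inc c))))) (move c a)

/-- The program that moves the head to the start of the tape. -/
def rewind : CounterProgram :=
  whl .behind (act .retreat)

theorem run_clear (a : ℕ) :
    Run (clear a) ⟨r, u, v, o⟩ (2 * r a + 1) ⟨update r a 0, u, v, o⟩ := by
  refine (run_countdown 1 (r a) (fun i => ⟨update r a (r a - i), u, v, o⟩) (by simp)
    fun i _ => (Run.act _ _).cast rfl ?_ le_rfl).cast (by simp) (by simp) (by omega)
  simp [Action.apply, Nat.sub_sub]

theorem run_move {a b : ℕ} (hab : a ≠ b) : Run (move a b) ⟨r, u, v, o⟩ (3 * r a + 1)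
    ⟨update (update r a 0) b (r b + r a), u, v, o⟩ := by
  refine (run_countdown 2 (r a) (fun i => ⟨update (update r a (r a - i)) b (r b + i), u, v, o⟩)
    (by simp [hab]) fun i _ => ((Run.act _ _).seq (.act _ _)).cast rfl ?_ le_rfl).cast
    (by simp) (by simp) (by omega)
  simp only [Action.apply, Store.mk.injEq, and_true]
  grind

theorem run_copy {a b c : ℕ} (hab : a ≠ b) (hac : a ≠ c) (hbc : b ≠ c) (hc : r c = 0) :
    Run (copy a b c) ⟨r, u, v, o⟩ (7 * r a + 2) ⟨update r b (r b + r a), u, v, o⟩ := by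
  have split := run_countdown (a := a) (p := seq (act (.dec a)) (seq (act (.inc b)) (act (.inc c))))
    3 (r a) (fun i => ⟨update (update (update r a (r a - i)) b (r b + i)) c i, u, v, o⟩)
    (by simp [hab, hac]) fun i _ => ((Run.act _ _).seq ((Run.act _ _).seq (.act _ _))).cast rfl ?_
    le_rfl
  · refine (split.seq (run_move _ u v o hac.symm)).cast (Store.mk_congr fun j => ?_)
      (Store.mk_congr fun j => ?_) (by simp only [tsub_self, update_self]; omega) <;>
    · simp only [update_apply]
      grind
  · refine Store.mk_congr fun j => ?_
    simp only [Action.apply, update_apply]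
    grind

theorem run_rewind :
    Run rewind ⟨r, u, v, o⟩ (2 * v.length + 1) ⟨r, v.reverse ++ u, [], o⟩ := by
  induction v generalizing u with
  | nil => exact .ended rfl
  | cons x v ih =>
    refine (Run.loop (s := ⟨r, u, x :: v, o⟩) rfl (.act .retreat _) (ih (x :: u))).cast rfl
      (by simp) ?_
    simp only [List.length_cons]
    omega

/-- The store with the word `w` on the tape and the head at position `i`. -/
def Store.at (r : ℕ → ℕ) (w : List (Option Bool)) (i : ℕ) (o : List Bool) : Store :=
  ⟨r, w.drop i, (w.take i).reverse, o⟩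

theorem Store.at_zero : Store.at r u 0 o = ⟨r, u, [], o⟩ := by
  simp [Store.at]

theorem run_advance (i : ℕ) :
    Run (act .advance) (.at r u i o) 1 (.at r u (i + 1) o) := by
  refine (Run.act _ _).cast rfl ?_ le_rfl
  rcases lt_or_ge i u.length with h | h
  · simp only [Action.apply, Store.at, List.head?_drop, List.tail_drop, Store.mk.injEq, true_and,
      and_true]
    rw [List.take_add_one, List.reverse_append]
    simp [h]
  · have h' := h.trans i.le_succ
    rw [Store.at, Store.at, List.drop_of_length_le h, List.take_of_length_le h,
      List.drop_of_length_le h', List.take_of_length_le h']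
    rfl

theorem run_rewind_at (i : ℕ) :
    Run rewind (.at r u i o) (2 * u.length + 1) ⟨r, u, [], o⟩ :=
  (run_rewind r (u.drop i) (u.take i).reverse o).cast rfl (by simp) (by simp)

end Programs

/-! ### Functions computable by counter programs in polynomial time -/

/-- The inputs of computations by counter programs: a word on the tape, and parameters held in
registers. -/
class Input (α : Type*) where
  word : α → List (Option Bool)
  params : α → List ℕ

/-- An input with one more parameter. -/
instance {α : Type*} [Input α] : Input (α × ℕ) where
  word a := Input.word a.1
  params a := a.2 :: Input.params a.1

open Input

/-- The size of an input in terms of which running times are measured; parameters count by value,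
since registers are unary counters. -/
def size {α : Type*} [Input α] (a : α) : ℕ :=
  (word a).length + (params a).sum

theorem size_prodMk {α : Type*} [Input α] (a : α) (n : ℕ) : size (a, n) = size a + n := by
  simp only [size, word, params, List.sum_cons]
  omega

/-- The program `p` finds the parameters in the registers `ρ` and writes `f` to the register `d`
within time `T`, while all registers from `d` on are available as scratch memory. -/
def Computes {α : Type*} [Input α] (p : CounterProgram) (ρ : List ℕ) (d : ℕ) (f : α → ℕ)
    (T : Polynomial ℕ) : Prop :=
  ∀ (a : α) (r : ℕ → ℕ) (o : List Bool), ρ.map r = params a → (∀ j ≥ d, r j = 0) →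
    Run p ⟨r, word a, [], o⟩ (T.eval (size a)) ⟨Function.update r d (f a), word a, [], o⟩

/-- The function `f` has polynomially bounded values and is computed by counter programs in
polynomial time, for every placement of the parameters. -/
def PolyTime {α : Type*} [Input α] (f : α → ℕ) : Prop :=
  ∃ T : Polynomial ℕ, (∀ a, f a ≤ T.eval (size a)) ∧
    ∀ (ρ : List ℕ) (d : ℕ), (∀ i ∈ ρ, i < d) → ∃ p, Computes p ρ d f T

theorem eval_le_eval (T : Polynomial ℕ) {m n : ℕ} (h : m ≤ n) : T.eval m ≤ T.eval n := by
  simp only [Polynomial.eval_eq_sum, Polynomial.sum]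
  gcongr

theorem map_update_eq {ρ l : List ℕ} {r : ℕ → ℕ} {d : ℕ} (h : ρ.map r = l)
    (hρ : ∀ i ∈ ρ, i < d) {j : ℕ} (hj : d ≤ j) (x : ℕ) : ρ.map (Function.update r j x) = l :=
  h ▸ List.map_congr_left fun i hi => Function.update_of_ne (by have := hρ i hi; omega) _ _

namespace PolyTime

open Function

variable {α : Type*} [Input α] {f g : α → ℕ}

theorem of_eq (hf : PolyTime f) (h : ∀ a, g a = f a) : PolyTime g :=
  funext h ▸ hf

theorem zero : PolyTime fun _ : α => 0 := by
  refine ⟨1, by simp, fun ρ d _ => ⟨act (.dec d), fun a r o _ hr => ?_⟩⟩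
  refine (Run.act _ _).cast rfl ?_ (by simp)
  simp [Action.apply, hr d le_rfl]

theorem succ (hf : PolyTime f) : PolyTime fun a => f a + 1 := by
  obtain ⟨T, hT, hp⟩ := hf
  refine ⟨T + 1, by simpa using hT, fun ρ d hρ => ?_⟩
  obtain ⟨p, hp⟩ := hp ρ d hρ
  refine ⟨seq p (act (.inc d)), fun a r o ha hr => ?_⟩
  exact ((hp a r o ha hr).seq (.act _ _)).cast rfl (by simp [Action.apply]) (by simp)

theorem snd : PolyTime (Prod.snd : α × ℕ → ℕ) := by
  have hsize : ∀ a : α × ℕ, a.2 ≤ size a := fun a => by simp [size_prodMk a.1 a.2]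
  refine ⟨7 * .X + 2, fun a => ?_, fun ρ d hρ => ?_⟩
  · have := hsize a
    simp only [Polynomial.eval_add, Polynomial.eval_mul, Polynomial.eval_ofNat, Polynomial.eval_X]
    omega
  rcases ρ with _ | ⟨i, ρ⟩
  · exact ⟨act .discard, fun a r o ha _ => absurd ha (by simp [params])⟩
  have hi : i < d := hρ i (by simp)
  refine ⟨copy i d (d + 1), fun a r o ha hr => ?_⟩
  obtain ⟨hia, -⟩ : r i = a.2 ∧ ρ.map r = params a.1 := by simpa [params] using ha
  refine (run_copy r _ _ o hi.ne (by omega) (by omega) (hr _ (by omega))).cast rfl ?_ ?_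
  · simp [hr d le_rfl, hia]
  · simpa [hia] using hsize a

theorem eraseParam {β : Type*} [Input β] {φ : β → α} (k : ℕ) (hw : ∀ b, word (φ b) = word b)
    (hk : ∀ b, params (φ b) = (params b).eraseIdx k) (hf : PolyTime f) :
    PolyTime fun b => f (φ b) := by
  obtain ⟨T, hT, hp⟩ := hf
  have hsize : ∀ b, T.eval (size (φ b)) ≤ T.eval (size b) := fun b => by
    refine eval_le_eval T ?_
    simp only [size, hw, hk]
    exact Nat.add_le_add_left ((List.eraseIdx_sublist _ _).sum_le_sum fun _ _ => Nat.zero_le _) _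
  refine ⟨T, fun b => (hT _).trans (hsize b), fun ρ d hρ => ?_⟩
  obtain ⟨p, hp⟩ := hp (ρ.eraseIdx k) d fun i hi => hρ i (List.mem_of_mem_eraseIdx hi)
  refine ⟨p, fun b r o hb hr => hw b ▸ (hp (φ b) r o ?_ hr).mono (hsize b)⟩
  rw [hk, ← hb, List.eraseIdx_map]

theorem fst (hf : PolyTime f) : PolyTime fun a : α × ℕ => f a.1 :=
  hf.eraseParam 0 (fun _ => rfl) fun _ => rfl

theorem fst_fst_snd {f : α × ℕ → ℕ} (hf : PolyTime f) :
    PolyTime fun a : (α × ℕ) × ℕ => f (a.1.1, a.2) :=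
  hf.eraseParam (φ := fun a : (α × ℕ) × ℕ => (a.1.1, a.2)) 1 (fun _ => rfl) fun _ => rfl

theorem length_word : PolyTime fun a : α => (word a).length := by
  have hsize : ∀ a : α, (word a).length ≤ size a := fun a => by simp [size]
  refine ⟨5 * .X + 2, fun a => ?_, fun ρ d _ => ?_⟩
  · have := hsize a
    simp only [Polynomial.eval_add, Polynomial.eval_mul, Polynomial.eval_ofNat, Polynomial.eval_X]
    omega
  refine ⟨seq (whl .ahead (seq (act .advance) (act (.inc d)))) rewind, fun a r o _ hr => ?_⟩
  have count := run_whl (b := .ahead) (p := seq (act .advance) (act (.inc d))) 2 (word a).length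
    (fun i => .at (update r d i) (word a) i o) (fun i hi => ⟨by simpa [Test.holds, Store.at], ?_⟩)
    (by simp [Test.holds, Store.at])
  · refine (count.seq (run_rewind_at _ _ o _)).cast ?_ rfl ?_
    · simp [Store.at_zero, update_eq_self_iff, hr d le_rfl]
    · have := hsize a
      simp only [Polynomial.eval_add, Polynomial.eval_mul, Polynomial.eval_ofNat, Polynomial.eval_X]
      omega
  · refine ((run_advance _ _ o i).seq (.act _ _)).cast rfl ?_ le_rfl
    simp [Action.apply, Store.at]

theorem comp {h : α × ℕ → ℕ} (hh : PolyTime h) (hg : PolyTime g) :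
    PolyTime fun a => h (a, g a) := by
  obtain ⟨H, hH, hp⟩ := hh
  obtain ⟨G, hG, hq⟩ := hg
  have hsize : ∀ a, H.eval (size (a, g a)) ≤ (H.comp (.X + G)).eval (size a) := fun a => by
    rw [Polynomial.eval_comp]
    exact eval_le_eval H (by simp [size_prodMk, hG])
  refine ⟨G + H.comp (.X + G) + (2 * G + 1) + (3 * H.comp (.X + G) + 1), fun a => ?_,
    fun ρ d hρ => ?_⟩
  · have := (hH (a, g a)).trans (hsize a)
    simp only [Polynomial.eval_add]
    omega
  obtain ⟨q, hq⟩ := hq ρ d hρ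
  obtain ⟨p, hp⟩ := hp (d :: ρ) (d + 1) (by simpa using fun i hi => (hρ i hi).trans d.lt_succ_self)
  refine ⟨seq (seq (seq q p) (clear d)) (move (d + 1) d), fun a r o ha hr => ?_⟩
  have inner := hp (a, g a) (update r d (g a)) o (by simp [params, map_update_eq ha hρ])
    fun j hj => by rw [update_of_ne (by omega), hr j (by omega)]
  refine ((((hq a r o ha hr).seq inner).seq (run_clear _ _ _ _ d)).seq
    (run_move _ _ _ _ (Nat.succ_ne_self d))).cast rfl (Store.mk_congr fun j => ?_) ?_
  · simp only [update_apply]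
    grind
  · have := hsize a
    have := hG a
    have := hH (a, g a)
    simp only [Nat.succ_eq_add_one, ne_eq, Nat.left_eq_add, Nat.add_eq_left, one_ne_zero,
      not_false_eq_true, update_of_ne, update_self, Polynomial.eval_add, Polynomial.eval_mul,
      Polynomial.eval_ofNat, Polynomial.eval_one]
    omega

theorem bit (hf : PolyTime f) :
    PolyTime fun a => if (word a)[f a]? = some (some true) then 1 else 0 := by
  obtain ⟨T, hT, hp⟩ := hf
  refine ⟨T + (3 * T + 1) + 1 + (2 * .X + 1), fun a => ?_, fun ρ d hρ => ?_⟩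
  · simp only [Polynomial.eval_add, Polynomial.eval_one]
    split_ifs <;> omega
  obtain ⟨p, hp⟩ := hp ρ d hρ
  refine ⟨seq (seq (seq p (whl (.pos d) (seq (act (.dec d)) (act .advance)))) (act (.scan d)))
    rewind, fun a r o ha hr => ?_⟩
  have decrement (i : ℕ) : Run (act (.dec d)) (.at (update r d (f a - i)) (word a) i o) 1
      (.at (update r d (f a - (i + 1))) (word a) i o) :=
    (Run.act _ _).cast rfl (by simp [Action.apply, Store.at, Nat.sub_sub]) le_rfl
  have skip := run_countdown (a := d) (p := seq (act (.dec d)) (act .advance)) 2 (f a)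
    (fun i => .at (update r d (f a - i)) (word a) i o) (by simp [Store.at])
    fun i _ => (decrement i).seq (run_advance _ _ o i)
  have scanned : Run (act (.scan d)) (.at (update r d 0) (word a) (f a) o) 1
      (.at (update r d (if (word a)[f a]? = some (some true) then 1 else 0)) (word a) (f a) o) := by
    refine (Run.act _ _).cast rfl ?_ le_rfl
    split_ifs with h <;> simp [Action.apply, Store.at, h]
  refine ((((hp a r o ha hr).seq (skip.cast (by simp [Store.at_zero]) (by simp) le_rfl)).seq
    scanned).seq (run_rewind_at _ _ o (f a))).cast rfl rfl ?_
  have := hT a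
  have : (word a).length ≤ size a := by simp [size]
  simp only [Polynomial.eval_add, Polynomial.eval_mul, Polynomial.eval_ofNat, Polynomial.eval_one,
    Polynomial.eval_X]
  omega

end PolyTime

section Recursion

open Function Input

/-- The loop body of a recursion: registers `d`, `d + 1` and `d + 2` hold the current value, the
number of remaining rounds and the number of completed rounds, and `p` writes the next value to
`d + 3`. -/
def recursionStep (p : CounterProgram) (d : ℕ) : CounterProgram :=
  seq (seq (seq (seq (act (.dec (d + 1))) p) (clear d)) (move (d + 3) d)) (act (.inc (d + 2)))

theorem run_recursionStep {α : Type*} [Input α] {h : (α × ℕ) × ℕ → ℕ} {H : Polynomial ℕ}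
    {ρ : List ℕ} {d : ℕ} {p : CounterProgram} (hp : Computes p (d :: (d + 2) :: ρ) (d + 3) h H)
    (hρ : ∀ i ∈ ρ, i < d) {a : α} {r : ℕ → ℕ} (o : List Bool) (ha : ρ.map r = params a)
    (hr : ∀ j ≥ d, r j = 0) (y k i : ℕ) :
    Run (recursionStep p d) ⟨update (update (update r d y) (d + 1) k) (d + 2) i, word a, [], o⟩
      (H.eval (size ((a, i), y)) + 2 * y + 3 * h ((a, i), y) + 4)
      ⟨update (update (update r d (h ((a, i), y))) (d + 1) (k - 1)) (d + 2) (i + 1),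
        word a, [], o⟩ := by
  have next := hp ((a, i), y) (update (update (update r d y) (d + 1) (k - 1)) (d + 2) i) o
    (by simpa [params] using map_update_eq (map_update_eq (map_update_eq ha hρ le_rfl y) hρ
      d.le_succ (k - 1)) hρ (d.le_add_right 2) i)
    fun j hj => by grind
  refine ((((((Run.act _ _).seq (next.cast (Store.mk_congr fun j => ?_) rfl le_rfl)).seq
    (run_clear _ _ _ _ d)).seq (run_move _ _ _ _ (by omega))).seq (.act _ _))).cast rfl
    (Store.mk_congr fun j => ?_) ?_
  · simp only [update_apply]
    grind
  · simp only [update_apply]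
    grind
  · simp
    omega

end Recursion

namespace PolyTime

open Function Input

variable {α : Type*} [Input α] {f g c : α → ℕ}

theorem recursion {y : α → ℕ → ℕ} {h : (α × ℕ) × ℕ → ℕ} (hg : PolyTime g) (hh : PolyTime h)
    (hc : PolyTime c) (y_zero : ∀ a, y a 0 = g a) (y_succ : ∀ a i, y a (i + 1) = h ((a, i), y a i))
    (Y : Polynomial ℕ) (hy : ∀ a, ∀ i ≤ c a, y a i ≤ Y.eval (size a)) :
    PolyTime fun a => y a (c a) := by
  obtain ⟨G, -, hq⟩ := hg
  obtain ⟨H, -, hp⟩ := hh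
  obtain ⟨C, hC, hn⟩ := hc
  let B := H.comp (.X + C + Y) + 5 * Y + 4
  refine ⟨Y + G + C + (C * (B + 1) + 1) + (2 * C + 1), fun a => ?_, fun ρ d hρ => ?_⟩
  · have := hy a _ le_rfl
    simp only [Polynomial.eval_add]
    omega
  obtain ⟨q, hq⟩ := hq ρ d hρ
  obtain ⟨n, hn⟩ := hn ρ (d + 1) fun i hi => (hρ i hi).trans d.lt_succ_self
  obtain ⟨p, hp⟩ := hp (d :: (d + 2) :: ρ) (d + 3) (by
    simpa using fun i hi => (hρ i hi).trans (by omega))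
  refine ⟨seq (seq (seq q n) (whl (.pos (d + 1)) (recursionStep p d))) (clear (d + 2)),
    fun a r o ha hr => ?_⟩
  have rounds := hn a (update r d (g a)) o (map_update_eq ha hρ le_rfl _) fun j hj => by
    rw [update_of_ne (by omega), hr j (by omega)]
  have time_step (i : ℕ) (hi : i < c a) : H.eval (size ((a, i), y a i)) + 2 * y a i +
      3 * h ((a, i), y a i) + 4 ≤ B.eval (size a) := by
    have := hC a
    have := hy a i hi.le
    have := y_succ a i ▸ hy a (i + 1) hi
    have : H.eval (size ((a, i), y a i)) ≤ H.eval (size a + C.eval (size a) + Y.eval (size a)) :=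
      eval_le_eval H (by simp only [size_prodMk]; omega)
    simp only [B, Polynomial.eval_add, Polynomial.eval_mul, Polynomial.eval_comp, Polynomial.eval_X,
      Polynomial.eval_ofNat]
    omega
  have loop := run_countdown (a := d + 1) (B.eval (size a)) (c a)
    (fun i => ⟨update (update (update r d (y a i)) (d + 1) (c a - i)) (d + 2) i, word a, [], o⟩)
    (by simp) fun i hi => (run_recursionStep hp hρ o ha hr (y a i) (c a - i) i).cast rfl
      (by simp [y_succ, Nat.sub_sub]) (time_step i hi)
  refine ((((hq a r o ha hr).seq rounds).seq (loop.cast (Store.mk_congr fun j => ?_) rfl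
    le_rfl)).seq (run_clear _ _ _ _ (d + 2))).cast rfl (Store.mk_congr fun j => ?_) ?_
  iterate 2
    · simp only [update_apply]
      grind
  · have := hC a
    have : c a * (B.eval (size a) + 1) ≤ C.eval (size a) * (B.eval (size a) + 1) := by gcongr
    simp only [tsub_self, update_self, Polynomial.eval_add, Polynomial.eval_mul,
      Polynomial.eval_ofNat, Polynomial.eval_one]
    omega

end PolyTime

/-- A property that counter programs decide in polynomial time. -/
def PolyTimePred {α : Type*} [Input α] (P : α → Prop) : Prop :=
  ∃ f : α → ℕ, PolyTime f ∧ ∀ a, P a ↔ f a = 0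

section Arithmetic

open Input

variable {α : Type*} [Input α] {f g h c : α → ℕ} {P Q : α → Prop}

namespace PolyTime

theorem exists_le (hf : PolyTime f) : ∃ T : Polynomial ℕ, ∀ a, f a ≤ T.eval (size a) :=
  hf.imp fun _ h => h.1

theorem const (k : ℕ) : PolyTime fun _ : α => k := by
  induction k with
  | zero => exact zero
  | succ k ih => exact ih.succ

theorem add (hf : PolyTime f) (hg : PolyTime g) : PolyTime fun a => f a + g a := by
  obtain ⟨F, hF⟩ := hf.exists_le
  obtain ⟨G, hG⟩ := hg.exists_le
  refine recursion (y := fun a i => f a + i) hf snd.succ hg (fun _ => rfl) (fun _ _ => rfl) (F + G)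
    fun a i hi => ?_
  simpa using Nat.add_le_add (hF a) (hi.trans (hG a))

theorem sum {f : α × ℕ → ℕ} (hf : PolyTime f) (hc : PolyTime c) :
    PolyTime fun a => ∑ i ∈ Finset.range (c a), f (a, i) := by
  obtain ⟨F, hF⟩ := hf.exists_le
  obtain ⟨C, hC⟩ := hc.exists_le
  refine recursion (y := fun a i => ∑ j ∈ Finset.range i, f (a, j)) zero (snd.add hf.fst) hc
    (fun _ => Finset.sum_range_zero _) (fun _ _ => Finset.sum_range_succ _ _)
    (C * F.comp (.X + C)) fun a i hi => ?_
  have term_le : ∀ j ∈ Finset.range i, f (a, j) ≤ (F.comp (.X + C)).eval (size a) := fun j hj => by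
    rw [Polynomial.eval_comp]
    refine (hF (a, j)).trans (eval_le_eval F ?_)
    have := hC a
    have := Finset.mem_range.1 hj
    simp only [size_prodMk, Polynomial.eval_add, Polynomial.eval_X]
    omega
  refine (Finset.sum_le_card_nsmul _ _ _ term_le).trans ?_
  rw [Finset.card_range, smul_eq_mul, Polynomial.eval_mul]
  gcongr
  exact hi.trans (hC a)

theorem mul (hf : PolyTime f) (hg : PolyTime g) : PolyTime fun a => f a * g a :=
  (hg.fst.sum hf).of_eq fun a => by simp

theorem pow (hf : PolyTime f) (k : ℕ) : PolyTime fun a => f a ^ k := by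
  induction k with
  | zero => exact const 1
  | succ k ih => exact ih.mul hf

theorem pred (hf : PolyTime f) : PolyTime fun a => f a - 1 := by
  obtain ⟨F, hF⟩ := hf.exists_le
  exact recursion (y := fun _ i => i - 1) zero snd.fst hf (fun _ => rfl) (fun _ _ => rfl) F
    fun a i hi => (Nat.sub_le i 1).trans (hi.trans (hF a))

theorem sub (hf : PolyTime f) (hg : PolyTime g) : PolyTime fun a => f a - g a := by
  obtain ⟨F, hF⟩ := hf.exists_le
  exact recursion (y := fun a i => f a - i) hf snd.pred hg (fun _ => rfl) (fun _ _ => rfl) F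
    fun a i _ => (Nat.sub_le _ _).trans (hF a)

end PolyTime

namespace PolyTimePred

theorem of_iff (hP : PolyTimePred P) (h : ∀ a, Q a ↔ P a) : PolyTimePred Q :=
  funext (fun a => propext (h a)) ▸ hP

theorem le (hf : PolyTime f) (hg : PolyTime g) : PolyTimePred fun a => f a ≤ g a :=
  ⟨_, hf.sub hg, fun _ => Nat.sub_eq_zero_iff_le.symm⟩

theorem lt (hf : PolyTime f) (hg : PolyTime g) : PolyTimePred fun a => f a < g a :=
  le hf.succ hg

theorem not (hP : PolyTimePred P) : PolyTimePred fun a => ¬P a := by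
  obtain ⟨p, hp, h⟩ := hP
  exact ⟨_, (PolyTime.const 1).sub hp, fun a => by simp only [h]; omega⟩

theorem and (hP : PolyTimePred P) (hQ : PolyTimePred Q) : PolyTimePred fun a => P a ∧ Q a := by
  obtain ⟨p, hp, h⟩ := hP
  obtain ⟨q, hq, h'⟩ := hQ
  exact ⟨_, hp.add hq, fun a => by simp [h, h']⟩

theorem or (hP : PolyTimePred P) (hQ : PolyTimePred Q) : PolyTimePred fun a => P a ∨ Q a := by
  obtain ⟨p, hp, h⟩ := hP
  obtain ⟨q, hq, h'⟩ := hQ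
  exact ⟨_, hp.mul hq, fun a => by simp [h, h']⟩

theorem imp (hP : PolyTimePred P) (hQ : PolyTimePred Q) : PolyTimePred fun a => P a → Q a :=
  (hP.not.or hQ).of_iff fun _ => imp_iff_not_or

theorem eq (hf : PolyTime f) (hg : PolyTime g) : PolyTimePred fun a => f a = g a :=
  ((le hf hg).and (le hg hf)).of_iff fun _ => le_antisymm_iff

theorem forall_lt {P : α × ℕ → Prop} (hc : PolyTime c) (hP : PolyTimePred P) :
    PolyTimePred fun a => ∀ i < c a, P (a, i) := by
  obtain ⟨p, hp, h⟩ := hP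
  exact ⟨_, hp.sum hc, fun a => by simp [h, Finset.sum_eq_zero_iff]⟩

theorem exists_lt {P : α × ℕ → Prop} (hc : PolyTime c) (hP : PolyTimePred P) :
    PolyTimePred fun a => ∃ i < c a, P (a, i) :=
  (forall_lt hc hP.not).not.of_iff fun a => by push Not; rfl

theorem getElem?_word (hf : PolyTime f) :
    PolyTimePred fun a => (word a)[f a]? = some (some true) :=
  ⟨_, (PolyTime.const 1).sub hf.bit, fun a => by split_ifs with h <;> simp [h]⟩

end PolyTimePred

namespace PolyTime

open Classical in
theorem ite (hP : PolyTimePred P) (hf : PolyTime f) (hg : PolyTime g) :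
    PolyTime fun a => if P a then f a else g a := by
  obtain ⟨p, hp, h⟩ := hP
  refine ((((const 1).sub hp).mul hf).add (((const 1).sub ((const 1).sub hp)).mul hg)).of_eq
    fun a => ?_
  rcases Nat.eq_zero_or_pos (p a) with h₀ | h₀
  · simp [h, h₀]
  · simp [h, h₀.ne', Nat.sub_eq_zero_of_le h₀]

theorem of_isLeast {P : α × ℕ → Prop} (hc : PolyTime c) (hP : PolyTimePred P)
    (h : ∀ a, IsLeast {k | k = c a ∨ P (a, k)} (f a)) : PolyTime f := by
  classical
  obtain ⟨C, hC⟩ := hc.exists_le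
  obtain ⟨q, hq, hQ⟩ := (PolyTimePred.eq snd hc.fst).or hP
  have search : PolyTime fun a => min (c a) (f a) := by
    refine recursion (y := fun a i => min i (f a)) zero
      (ite ⟨_, hq.fst_fst_snd, fun a => hQ (a.1.1, a.2)⟩ snd snd.succ) hc (fun a => Nat.zero_min _)
      (fun a i => ?_) C fun a i hi => (min_le_left _ _).trans (hi.trans (hC a))
    rcases lt_or_ge i (f a) with hi | hi
    · have : ¬(i = c a ∨ P (a, i)) := fun hP => hi.not_ge ((h a).2 hP)
      simp [min_eq_left hi.le, min_eq_left (Nat.succ_le_of_lt hi), this]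
    · have : f a = c a ∨ P (a, f a) := (h a).1
      simp [min_eq_right hi, min_eq_right (hi.trans i.le_succ), this]
  exact search.of_eq fun a => (min_eq_right ((h a).2 (.inl rfl))).symm

theorem div (hf : PolyTime f) (hg : PolyTime g) : PolyTime fun a => f a / g a := by
  refine of_isLeast (P := fun b => g b.1 = 0 ∨ f b.1 < (b.2 + 1) * g b.1) hf
    ((PolyTimePred.eq hg.fst zero).or (.lt hf.fst (snd.succ.mul hg.fst))) fun a => ?_
  rcases Nat.eq_zero_or_pos (g a) with h₀ | h₀
  · simp [h₀, IsLeast, lowerBounds]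
  · refine ⟨.inr (.inr (Nat.lt_mul_of_div_lt (Nat.lt_succ_self _) h₀)), ?_⟩
    rintro k (rfl | h | h)
    · exact Nat.div_le_self _ _
    · exact absurd h h₀.ne'
    · exact Nat.lt_succ_iff.1 ((Nat.div_lt_iff_lt_mul h₀).2 h)

theorem mod (hf : PolyTime f) (hg : PolyTime g) : PolyTime fun a => f a % g a :=
  (hf.sub (hg.mul (hf.div hg))).of_eq fun _ => Nat.mod_eq_sub_mul_div

theorem div_pow (hf : PolyTime f) (hg : PolyTime g) (hc : PolyTime c) :
    PolyTime fun a => f a / g a ^ c a := by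
  obtain ⟨F, hF⟩ := hf.exists_le
  exact recursion (y := fun a i => f a / g a ^ i) hf (snd.div hg.fst.fst) hc (fun _ => by simp)
    (fun _ _ => by rw [pow_succ, Nat.div_div_eq_div_mul]) F
    fun a _ _ => (Nat.div_le_self _ _).trans (hF a)

end PolyTime

theorem PolyTimePred.lt_pow (hf : PolyTime f) (hg : PolyTime g) (hc : PolyTime c)
    (hg₀ : ∀ a, g a ≠ 0) : PolyTimePred fun a => f a < g a ^ c a :=
  (eq (hf.div_pow hg hc) .zero).of_iff fun a => by
    simp [Nat.div_eq_zero_iff, hg₀ a]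

end Arithmetic

section Output

open Computability Function

/-- The increment of a binary number, least significant digit first. -/
def binSucc : List Bool → List Bool
  | [] => [true]
  | false :: l => true :: l
  | true :: l => false :: binSucc l

theorem encodePosNum_succ (n : PosNum) : encodePosNum n.succ = binSucc (encodePosNum n) := by
  induction n with
  | one => rfl
  | bit0 n _ => rfl
  | bit1 n ih => simp [PosNum.succ, encodePosNum, binSucc, ih]

theorem encodeNat_succ (n : ℕ) : encodeNat (n + 1) = binSucc (encodeNat n) := by
  simp only [encodeNat, Nat.cast_succ, Num.add_one]
  cases (n : Num) with
  | zero => rfl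
  | pos n => exact encodePosNum_succ n

theorem exists_binSucc_eq (l : List Bool) : ∃ (j : ℕ) (l' : List Bool), l'.head? ≠ some true ∧
    l = List.replicate j true ++ l' ∧ binSucc l = List.replicate j false ++ true :: l'.tail := by
  induction l with
  | nil => exact ⟨0, [], by simp [binSucc]⟩
  | cons b l ih =>
    cases b with
    | false => exact ⟨0, false :: l, by simp [binSucc]⟩
    | true =>
      obtain ⟨j, l', h, h₁, h₂⟩ := ih
      exact ⟨j + 1, l', h, by simp [List.replicate_succ, ← h₁],
        by simp [List.replicate_succ, binSucc, ← h₂]⟩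

theorem length_binSucc_le (l : List Bool) : (binSucc l).length ≤ l.length + 1 := by
  obtain ⟨j, l', -, h₁, h₂⟩ := exists_binSucc_eq l
  rw [h₂, h₁]
  simp only [List.length_append, List.length_replicate, List.length_cons, List.length_tail]
  omega

theorem length_encodeNat_le (n : ℕ) : (encodeNat n).length ≤ n := by
  induction n with
  | zero => rfl
  | succ n ih =>
    rw [encodeNat_succ]
    exact (length_binSucc_le _).trans (Nat.succ_le_succ ih)

/-- The program that increments the binary number on the output tape, with register `a` as scratch
memory. -/
def increment (a : ℕ) : CounterProgram :=
  seq (seq (seq (whl .outTrue (seq (act .popOut) (act (.inc a)))) (act .popOut))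
    (act (.pushOut true))) (whl (.pos a) (seq (act (.dec a)) (act (.pushOut false))))

theorem run_increment {a : ℕ} {r : ℕ → ℕ} (hr : r a = 0) (u v : List (Option Bool))
    (o : List Bool) : Run (increment a) ⟨r, u, v, o⟩ (6 * o.length + 4) ⟨r, u, v, binSucc o⟩ := by
  obtain ⟨j, l, hl, rfl, h⟩ := exists_binSucc_eq o
  have carry := run_whl (b := .outTrue) (p := seq (act .popOut) (act (.inc a))) 2 j
    (fun i => ⟨update r a i, u, v, List.replicate (j - i) true ++ l⟩) (fun i hi => ?_)
    (by simpa [Test.holds] using hl)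
  · have fill := run_countdown (a := a) (p := seq (act (.dec a)) (act (.pushOut false))) 2 j
      (fun i => ⟨update r a (j - i), u, v, List.replicate i false ++ true :: l.tail⟩) (by simp)
      fun i _ => ((Run.act _ _).seq (.act _ _)).cast rfl
        (by simp [Action.apply, List.replicate_succ, Nat.sub_sub]) le_rfl
    refine (((carry.seq (.act _ _)).seq (.act _ _)).seq
      (fill.cast (by simp [Action.apply]) rfl le_rfl)).cast ?_ ?_ ?_
    · simp [update_eq_self_iff, hr]
    · simp [update_eq_self_iff, hr, h]
    · simp only [List.length_append, List.length_replicate]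
      omega
  · obtain ⟨k, rfl⟩ : ∃ k, j = i + 1 + k := Nat.exists_eq_add_of_le hi
    have : i + 1 + k - i = k + 1 := by omega
    refine ⟨by simp [Test.holds, this, List.replicate_succ],
      ((Run.act _ _).seq (.act _ _)).cast rfl ?_ le_rfl⟩
    simp [Action.apply, this, List.replicate_succ]

/-- The program that writes the value of register `0`, which it clears, to the output tape in
binary, with register `1` as scratch memory. -/
def output : CounterProgram :=
  whl (.pos 0) (seq (act (.dec 0)) (increment 1))

theorem run_output (n : ℕ) (u v : List (Option Bool)) :
    Run output ⟨update (fun _ => 0) 0 n, u, v, []⟩ (n * (6 * n + 6) + 1)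
      ⟨fun _ => 0, u, v, encodeNat n⟩ := by
  refine (run_countdown (a := 0) (6 * n + 5) n
    (fun i => ⟨update (fun _ => 0) 0 (n - i), u, v, encodeNat i⟩) (by simp) fun i hi => ?_).cast
    (by simp only [tsub_zero]; rfl) (by simp) le_rfl
  have decrement := (Run.act (.dec 0) ⟨update (fun _ => 0) 0 (n - i), u, v, encodeNat i⟩).cast
    (s'' := ⟨update (fun _ => 0) 0 (n - (i + 1)), u, v, encodeNat i⟩) rfl
    (by simp [Action.apply, Nat.sub_sub]) le_rfl
  refine (decrement.seq (run_increment (by simp) u v _)).cast rfl (by rw [encodeNat_succ]) ?_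
  have := length_encodeNat_le i
  omega

theorem run_discard (r : ℕ → ℕ) (u v : List (Option Bool)) (o : List Bool) :
    Run (whl .ahead (act .discard)) ⟨r, u, v, o⟩ (2 * u.length + 1) ⟨r, [], v, o⟩ := by
  induction u with
  | nil => exact .ended rfl
  | cons x u ih =>
    refine (Run.loop (s := ⟨r, x :: u, v, o⟩) rfl (.act .discard _) ih).mono ?_
    simp only [List.length_cons]
    omega

theorem PolyTime.nonempty_tm2ComputableInPolyTime {α : Type} [Input α] {f : α → ℕ}
    (hf : PolyTime f) (h : ∀ a : α, Input.params a = []) :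
    Nonempty (Turing.TM2ComputableInPolyTime (Input.word : α → _) encodeNat f) := by
  obtain ⟨T, hT, hp⟩ := hf
  obtain ⟨p, hp⟩ := hp [] 0 (by simp)
  refine CounterProgram.nonempty_tm2ComputableInPolyTime
    (seq (seq p output) (whl .ahead (act .discard)))
    (T + (T * (6 * T + 6) + 1) + (2 * .X + 1)) fun a => ?_
  refine (((hp a _ [] (by simp [h]) (by simp)).seq (run_output _ _ _)).seq
    (run_discard _ _ _ _)).mono ?_
  have hsize : size a = (Input.word a).length := by simp [size, h]
  have : f a * (6 * f a + 6) ≤ T.eval (size a) * (6 * T.eval (size a) + 6) := by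
    gcongr <;> exact hT a
  simp only [← hsize, Polynomial.eval_add, Polynomial.eval_mul, Polynomial.eval_ofNat,
    Polynomial.eval_one, Polynomial.eval_X]
  omega

end Output

/-! ### Running time of the algorithm -/

noncomputable instance : Input CoBipartiteGraph where
  word := CoBipartiteGraph.encode
  params _ := []

variable {α : Type*} [Input α]

theorem PolyTime.blockSize {f : α → ℕ} (hf : PolyTime f) : PolyTime fun a => blockSize (f a) :=
  of_isLeast (P := fun p => (f p.1 + 2) ^ 256 < (p.2 + 2) ^ (p.2 + 1) ^ 2) hf.succ
    (.lt_pow (hf.fst.succ.succ.pow 256) snd.succ.succ (snd.succ.pow 2) fun _ => by simp)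
    fun _ => isLeast_blockSize _

theorem PolyTime.codedRank {s b c j x : α → ℕ} (hs : PolyTime s) (hb : PolyTime b)
    (hc : PolyTime c) (hj : PolyTime j) (hx : PolyTime x) :
    PolyTime fun a => codedRank (s a) (b a) (c a) (j a) (x a) :=
  (ite (.eq (hx.div hs) hb) ((hc.div_pow hs.succ ((hj.mul hs).add (hx.mod hs))).mod hs.succ)
    zero).of_eq fun _ => by rw [_root_.codedRank]; congr

section Graphs

variable {G : α → CoBipartiteGraph} (hG : ∀ a, Input.word a = (G a).encode)
  {u v : α → ℕ} {r : α × ℕ → ℕ}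

include hG

theorem PolyTime.order : PolyTime fun a => (G a).order :=
  of_isLeast (P := fun p => (Input.word p.1).length ≤ p.2 * (p.2 + 1)) length_word
    (.le length_word.fst (snd.mul snd.succ)) fun a => by
      simpa only [hG] using (G a).isLeast_order

namespace PolyTimePred

theorem adj (hu : PolyTime u) (hv : PolyTime v) :
    PolyTimePred fun a => ∃ hu hv, (G a).graph.Adj ⟨u a, hu⟩ ⟨v a, hv⟩ :=
  ((lt hv (.order hG)).and (getElem?_word ((hu.mul (PolyTime.order hG).succ).add hv))).of_iff
    fun a => by
      rw [hG, exists_comm, ← exists_prop]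
      exact exists_congr fun hv => ((G a).getElem?_encode _ hv).symm

theorem isCliqueRank (hr : PolyTime r) :
    PolyTimePred fun a => IsCliqueRank (G a).graph fun x => r (a, x) := by
  have decide := forall_lt (.order hG) <| forall_lt (PolyTime.order hG).fst <|
    (eq hr.fst .zero).not.imp <| (eq hr.fst_fst_snd .zero).not.imp <|
      (eq PolyTime.snd.fst .snd).not.imp <|
        adj (G := fun a => G a.1.1) (fun a => hG a.1.1) PolyTime.snd.fst .snd
  refine decide.of_iff fun a => ⟨fun h x hx y hy hrx hry hxy => ?_, fun h x hrx y hry hxy => ?_⟩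
  · exact ⟨hx, hy, h (x := ⟨x, hx⟩) hrx (y := ⟨y, hy⟩) hry (Fin.ne_of_val_ne hxy)⟩
  · obtain ⟨_, _, hadj⟩ := h x x.2 y y.2 hrx hry (Fin.val_ne_of_ne hxy)
    exact hadj

theorem rankCovers (hr : PolyTime r) (hu : PolyTime u) (hv : PolyTime v) :
    PolyTimePred fun a => ∃ hu hv,
      RankCovers (G a).graph (fun x => r (a, x)) ⟨u a, hu⟩ ⟨v a, hv⟩ := by
  have decide := (lt hu (.order hG)).and <| (lt hv (.order hG)).and <|
    (eq (hr.comp hu) .zero).not.and <| forall_lt (.order hG) <| (le (hr.comp hu).fst hr).imp <|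
      (adj (G := fun a => G a.1) (fun a => hG a.1) .snd hv.fst).or (eq .snd hv.fst)
  refine decide.of_iff fun a => ⟨fun ⟨hu, hv, pos, h⟩ => ⟨hu, hv, pos, fun x hx hle => ?_⟩,
    fun ⟨hu, hv, pos, h⟩ => ⟨hu, hv, pos, fun x hle => ?_⟩⟩
  · exact (h ⟨x, hx⟩ hle).imp (⟨hx, hv, ·⟩) (congrArg Fin.val)
  · exact (h x x.2 hle).imp (fun ⟨_, _, hadj⟩ => hadj) Fin.ext

theorem isCodedCover {s b k c : α → ℕ} (hs : PolyTime s) (hb : PolyTime b) (hk : PolyTime k)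
    (hc : PolyTime c) :
    PolyTimePred fun a => IsCodedCover (G a).graph (s a) (b a) (k a) (c a) := by
  have cliques := forall_lt hk <| isCliqueRank (G := fun a => G a.1) (fun a => hG a.1) <|
    .codedRank hs.fst.fst hb.fst.fst hc.fst.fst PolyTime.snd.fst .snd
  have covers := forall_lt (.order hG) <| forall_lt (PolyTime.order hG).fst <|
    (eq (PolyTime.snd.fst.div hs.fst.fst) hb.fst.fst).imp <|
      (adj (G := fun a => G a.1.1) (fun a => hG a.1.1) PolyTime.snd.fst .snd).imp <|
        exists_lt hk.fst.fst <| rankCovers (G := fun a => G a.1.1.1) (fun a => hG a.1.1.1)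
          (.codedRank hs.fst.fst.fst.fst hb.fst.fst.fst.fst hc.fst.fst.fst.fst PolyTime.snd.fst
            .snd) PolyTime.snd.fst.fst PolyTime.snd.fst
  refine (cliques.and covers).of_iff fun a => and_congr_right'
    ⟨fun h u hu v hv hub ⟨_, _, huv⟩ => ?_, fun h u hub v huv => ?_⟩
  · obtain ⟨j, hj, cover⟩ := h ⟨u, hu⟩ hub ⟨v, hv⟩ huv
    exact ⟨j, hj, hu, hv, cover⟩
  · obtain ⟨j, hj, _, _, cover⟩ := h u u.2 v v.2 hub ⟨u.2, v.2, huv⟩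
    exact ⟨j, hj, cover⟩

end PolyTimePred

end Graphs

theorem PolyTime.blockRankCoverSum :
    PolyTime fun G : CoBipartiteGraph =>
      blockRankCoverSum G.graph (_root_.blockSize G.order) := by
  have order : PolyTime CoBipartiteGraph.order := .order fun _ => rfl
  have rankCoverNumber : PolyTime fun a : CoBipartiteGraph × ℕ =>
      rankCoverNumber a.1.graph (block a.1.order (_root_.blockSize a.1.order) a.2) :=
    of_isLeast order.blockSize.fst
      (.exists_lt (order.succ.succ.pow 256).fst.fst <|
        .isCodedCover (G := fun a => a.1.1.1) (fun _ => rfl) order.blockSize.fst.fst.fst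
          snd.fst.fst snd.fst snd)
      fun a => isLeast_rankCoverNumber_block (blockSize_pos _) (pow_blockSize_le _) _ _
  refine (rankCoverNumber.sum ((order.add order.blockSize).pred.div order.blockSize)).of_eq
    fun G => ?_
  rw [_root_.blockRankCoverSum, Nat.ceilDiv_eq_add_pred_div]

end CounterProgram

/-- There is a function `f` on co-bipartite graphs, computable by a Turing machine in time
polynomial in the length of the input (the adjacency matrix; the output is written in binary),
whose value approximates the threshold dimension within the factor
`2 ⌈n √(log log n) / √(log n)⌉`, where `n` is the number of vertices. -/
theorem mainTheorem5 :
    ∃ f : CoBipartiteGraph → ℕ,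
      Nonempty (Turing.TM2ComputableInPolyTime
        CoBipartiteGraph.encode Computability.encodeNat f) ∧
      ∀ G : CoBipartiteGraph, 3 ≤ G.order →
        G.graph.thresholdDim ≤ f G ∧
        (f G : ℝ) ≤
          2 * (⌈(G.order : ℝ) * √(Real.log (Real.log (G.order : ℝ))) /
                √(Real.log (G.order : ℝ))⌉₊ : ℝ) * (G.graph.thresholdDim : ℝ) := by
  refine ⟨fun G => blockRankCoverSum G.graph (blockSize G.order),
    CounterProgram.PolyTime.blockRankCoverSum.nonempty_tm2ComputableInPolyTime fun _ => rfl,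
    fun G hn => ⟨thresholdDim_le_blockRankCoverSum (blockSize_pos _) G.graph, ?_⟩⟩
  exact_mod_cast blockRankCoverSum_le G.compl_isBipartite (blockSize_pos _)
    (le_blockSize_mul_ceil hn)
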